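/- Let $(\Omega,\mathcal F,P)$ be a probability space, $\mathbb X,\mathbb Y$ Polish spaces ($\mathbb X\ne\emptyset$), $m\ge 1$ and $d\ge 0$ integers, and $N=\max(d+1,m)$. Let $x_t$ ($t\ge -N+1$) be an $\mathbb X$-valued source that is Markov of order $m$, let $d$ be the delay allowed at the decoder, and put $z_t=x_{[t-N+1,t]}=(x_{t-N+1},\dots,x_t)\in\mathbb X^{N}$. For $t\ge 0$ let $$x_{t+1}=f(x_{[t-m+1,t]},w_t),\qquad y_t=g(z_t,r_t)\in\mathbb Y,$$ with $f,g$ measurable, $(w_t)$ and $(r_t)$ i.i.d. sequences, and $z_0,(w_t),(r_t)$ mutually independent (the law of $z_0$ is arbitrary). Let $\mathcal M_t$ be finite sets, $T$ a horizon, $\mathbb U$ a decision space and $c:\mathbb X^{N}\times\mathbb U\to[0,\infty)$ bounded and measurable (for instance a function of $(x_t,v)$ only, or, with delay, of $(x_{t-d},v)$ only). A composite quantization policy $Q$ is a sequence of measurable maps giving $q_t=Q_t(y_{[0,t]},q_{[0,t-1]})\in\mathcal M_t$; a receiver policy $\gamma$ is a sequence of maps giving $v_t=\gamma_t(q_{[0,t]})\in\mathbb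 U$; and $J(Q,\gamma)=E\big[\sum_{t=0}^{T-1}c(z_t,v_t)\big]$. Call $Q$ optimal if it minimizes $\inf_\gamma J(Q,\gamma)$ over all composite quantization policies. Say that $Q$ is replaced by $Q'$ without loss in performance if for every $\gamma$ there is $\gamma'$ with $J(Q',\gamma')\le J(Q,\gamma)$; in particular $\inf_{\gamma}J(Q',\gamma)\le\inf_\gamma J(Q,\gamma)$. For a Polish space $\mathbb S$ let $\mathcal P(\mathbb S)$ be the space of probability measures on $\mathbb S$ with the Borel $\sigma$-field of the weak topology. Let $\pi_t\in\mathcal P(\mathbb X^{N})$ be the regular conditional law of $z_t$ given $y_{[0,t]}$ and, under a given composite quantization policy, let $\Xi_t\in\mathcal P(\mathcal P(\mathbb X^{N}))$ be the conditional law of $\pi_t$ given $q_{[0,t-1]}$ (for $t=0$, the law of $\pi_0$). Then: (i) Every composite quantization policy $Q$ can be replaced, without loss in performance, by one that at each time $t\ge0$ uses only $(\pi_t,q_{[0,t-1]})$: $q_{[0,t-1]}$ selects a measurable quantizer $\mathcal P(\mathbb X^{N})\to\mathcal M_t$, which is applied to $\pi_t$. Moreover, for every fixed receiver policy $\gamma$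 there is a policy $Q'$ of this form with $J(Q',\gamma)\le J(Q,\gamma)$. (ii) Every composite quantization policy, in particular every optimal one, can be replaced, without loss in performance, by one that at each time $t\ge0$ uses only $(\Xi_t,\pi_t,t)$, where $\Xi_t$ is the one induced by the new policy itself: $(\Xi_t,t)$ selects a quantizer $\mathcal P(\mathbb X^{N})\to\mathcal M_t$ (jointly measurably in $(\Xi_t,\pi_t)$), which is applied to $\pi_t$. If the original policy is optimal, then so is the new one. -/

import Mathlib

open MeasureTheory ProbabilityTheory

noncomputable section

namespace CausalCoding

/-- The window `x_{[t-n+1, t]}` of the `n` most recent source symbols at time `t`, oldest first.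
The time axis is `ℤ`, since windows at time `0` contain symbols with non-positive times. -/
def window {Ω X : Type*} (x : ℤ → Ω → X) (n : ℕ) (t : ℤ) (ω : Ω) : Fin n → X :=
  fun i => x (t - n + 1 + i) ω

/-- The memory length `max (d+1) m` of the augmented state. -/
abbrev memLen (m d : ℕ) : ℕ := max (d + 1) m

/-- A partially observed source which is Markov of order `m`, considered together with a decoding
delay `d`, on the probability space `(Ω, P)`. With `z_t = x_{[t-max(d+1,m)+1, t]}` the equations are
`x_{t+1} = f (x_{[t-m+1,t]}, w_t)` and `y_t = g (z_t, r_t)` for `t ≥ 0`, where `w` and `r` are i.i.d.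
sequences and `z_0`, `w`, `r` are mutually independent. The law of the initial window `z_0` is
arbitrary. Values of `x` at times before that window play no role. -/
structure Source {Ω : Type*} [MeasurableSpace Ω] (P : Measure Ω) (X Y W R : Type*)
    [MeasurableSpace X] [MeasurableSpace Y] [MeasurableSpace W] [MeasurableSpace R]
    (m d : ℕ) where
  /-- source process -/
  x : ℤ → Ω → X
  /-- observation process -/
  y : ℕ → Ω → Y
  /-- source noise -/
  w : ℕ → Ω → W
  /-- observation noise -/
  r : ℕ → Ω → R
  /-- source update -/
  f : (Fin m → X) × W → X
  /-- observation channel -/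
  g : (Fin (memLen m d) → X) × R → Y
  measurable_init : Measurable (window x (memLen m d) 0)
  measurable_w : ∀ t, Measurable (w t)
  measurable_r : ∀ t, Measurable (r t)
  measurable_f : Measurable f
  measurable_g : Measurable g
  source_eq : ∀ (t : ℕ) (ω : Ω), x (t + 1) ω = f (window x m t ω, w t ω)
  obs_eq : ∀ (t : ℕ) (ω : Ω), y t ω = g (window x (memLen m d) t ω, r t ω)
  indep_w : iIndepFun w P
  indep_r : iIndepFun r P
  identDistrib_w : ∀ t, IdentDistrib (w t) (w 0) P P
  identDistrib_r : ∀ t, IdentDistrib (r t) (r 0) P P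
  indep_w_r : IndepFun (fun ω t => w t ω) (fun ω t => r t ω) P
  indep_init : IndepFun (window x (memLen m d) 0)
    (fun ω => ((fun t => w t ω, fun t => r t ω) : (ℕ → W) × (ℕ → R))) P

/-- The past quantization outputs `q_{[0,t-1]}`; the output alphabet at time `s` is finite, with
`M s` elements. -/
abbrev Hist (M : ℕ → ℕ) (t : ℕ) : Type := (s : Fin t) → Fin (M s)

/-- A causal composite quantization policy: at time `t` the quantization output is a measurable
function of `y_{[0,t]}` and `q_{[0,t-1]}`. -/
structure Encoder (Y : Type*) [MeasurableSpace Y] (M : ℕ → ℕ) where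
  toFun : ∀ t : ℕ, (Fin (t + 1) → Y) → Hist M t → Fin (M t)
  measurable_toFun : ∀ t : ℕ,
    Measurable (fun p : (Fin (t + 1) → Y) × Hist M t => toFun t p.1 p.2)

/-- A causal receiver policy: `v_t = γ_t (q_{[0,t]})`. Every such map is measurable, since its
domain is finite. -/
abbrev Receiver (M : ℕ → ℕ) (U : Type*) : Type _ := ∀ t : ℕ, Hist M (t + 1) → U

/-- The quantization outputs `q_{[0,t-1]}` produced by `Q` along an observation sequence. -/
def Encoder.outputs {Y : Type*} [MeasurableSpace Y] {M : ℕ → ℕ} (Q : Encoder Y M) (y : ℕ → Y) :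
    ∀ t : ℕ, Hist M t
  | 0 => fun s => s.elim0
  | t + 1 => Fin.snoc (α := fun s : Fin (t + 1) => Fin (M s)) (Q.outputs y t)
      (Q.toFun t (fun s => y s) (Q.outputs y t))

namespace Source

variable {Ω X Y W R U : Type*} [MeasurableSpace Ω] {P : Measure Ω}
  [MeasurableSpace X] [MeasurableSpace Y] [MeasurableSpace W] [MeasurableSpace R]
  {m d : ℕ} {M : ℕ → ℕ}

/-- The augmented state `z_t = x_{[t-max(d+1,m)+1, t]}`. -/
def state (S : Source P X Y W R m d) (t : ℕ) (ω : Ω) : Fin (memLen m d) → X :=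
  window S.x (memLen m d) t ω

/-- The observations `y_{[0,t]}`. -/
def obs (S : Source P X Y W R m d) (t : ℕ) (ω : Ω) : Fin (t + 1) → Y := fun s => S.y s ω

/-- The random outputs `q_{[0,t-1]}` when the encoder uses `Q`. -/
def outputs (S : Source P X Y W R m d) (Q : Encoder Y M) (t : ℕ) (ω : Ω) : Hist M t :=
  Q.outputs (fun s => S.y s ω) t

lemma measurable_x (S : Source P X Y W R m d) (t : ℕ) :
    ∀ k : ℤ, -(memLen m d : ℤ) + 1 ≤ k → k ≤ t → Measurable (S.x k) := by
  induction t with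
  | zero =>
    intro k h1 h2
    have h := (measurable_pi_apply
      (⟨(k + memLen m d - 1).toNat, by push_cast at h2; omega⟩ :
        Fin (memLen m d))).comp S.measurable_init
    have hk : S.x k = fun ω => S.x (0 - (memLen m d : ℤ) + 1 + ((k + memLen m d - 1).toNat : ℤ)) ω :=
      by
        rw [show (0 - (memLen m d : ℤ) + 1 + ((k + memLen m d - 1).toNat : ℤ)) = k by omega]
    rw [hk]
    exact h
  | succ t ih =>
    intro k h1 h2
    rcases lt_or_ge k (t + 1) with h | h
    · exact ih k h1 (by omega)
    · obtain rfl : k = t + 1 := by push_cast at h2; omega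
      have : S.x (t + 1) = fun ω => S.f (window S.x m t ω, S.w t ω) :=
        funext (S.source_eq t)
      rw [this]
      refine S.measurable_f.comp (Measurable.prodMk (measurable_pi_lambda _ fun i => ?_)
        (S.measurable_w t))
      exact ih _ (by have := i.2; simp only [memLen] at *; omega) (by have := i.2; omega)

lemma measurable_state (S : Source P X Y W R m d) (t : ℕ) : Measurable (S.state t) :=
  measurable_pi_lambda _ fun i =>
    S.measurable_x t _ (by omega) (by have := i.2; omega)

lemma measurable_y (S : Source P X Y W R m d) (t : ℕ) : Measurable (S.y t) := by
  rw [show S.y t = fun ω => S.g (S.state t ω, S.r t ω) from funext (S.obs_eq t)]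
  exact S.measurable_g.comp ((S.measurable_state t).prodMk (S.measurable_r t))

lemma measurable_obs (S : Source P X Y W R m d) (t : ℕ) : Measurable (S.obs t) :=
  measurable_pi_lambda _ fun s => S.measurable_y s

section Belief

variable [IsProbabilityMeasure P] [TopologicalSpace X] [PolishSpace X] [BorelSpace X] [Nonempty X]

/-- The encoder's belief `π_t`: the regular conditional law of `z_t` given `y_{[0,t]}`, as a
function of the observed sequence. The `σ`-algebra carried by `ProbabilityMeasure` is generated by
the evaluations `μ ↦ μ A`; on a Polish space it is the Borel `σ`-algebra of weak convergence. -/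
def belief (S : Source P X Y W R m d) (t : ℕ) (y : Fin (t + 1) → Y) :
    ProbabilityMeasure (Fin (memLen m d) → X) :=
  ⟨condDistrib (S.state t) (S.obs t) P y, inferInstance⟩

lemma measurable_belief (S : Source P X Y W R m d) (t : ℕ) : Measurable (S.belief t) :=
  (Kernel.measurable _).subtype_mk

lemma measurable_belief_obs (S : Source P X Y W R m d) (t : ℕ) :
    Measurable (fun ω => S.belief t (S.obs t ω)) :=
  (S.measurable_belief t).comp (S.measurable_obs t)

open Classical in
/-- The receiver's belief `Ξ_t` on the encoder's belief: the conditional law of `π_t` given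
`q_{[0,t-1]} = h` when the encoder uses `Q`. On histories of probability zero, where the conditional
law is not determined, it is the unconditional law of `π_t`. -/
def beliefOnBelief (S : Source P X Y W R m d) (Q : Encoder Y M) (t : ℕ) (h : Hist M t) :
    ProbabilityMeasure (ProbabilityMeasure (Fin (memLen m d) → X)) :=
  if hpos : P {ω | S.outputs Q t ω = h} ≠ 0 then
    ⟨(cond P {ω | S.outputs Q t ω = h}).map (fun ω => S.belief t (S.obs t ω)),
      have := cond_isProbabilityMeasure hpos
      Measure.isProbabilityMeasure_map (S.measurable_belief_obs t).aemeasurable⟩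
  else
    ⟨P.map (fun ω => S.belief t (S.obs t ω)),
      Measure.isProbabilityMeasure_map (S.measurable_belief_obs t).aemeasurable⟩

/-- `Q` only uses `(π_t, q_{[0,t-1]})`: the outputs `q_{[0,t-1]}` select a quantizer of the space
of beliefs, and the quantizer is applied to `π_t`. -/
def UsesBeliefAndOutputs (S : Source P X Y W R m d) (Q : Encoder Y M) : Prop :=
  ∃ q : ∀ t : ℕ, Hist M t → ProbabilityMeasure (Fin (memLen m d) → X) → Fin (M t),
    (∀ t h, Measurable (q t h)) ∧
    ∀ t y h, Q.toFun t y h = q t h (S.belief t y)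

/-- `Q` only uses `(Ξ_t, π_t, t)`: the pair `(Ξ_t, t)` selects a quantizer of the space of beliefs,
and the quantizer is applied to `π_t`. Here `Ξ_t` is the belief induced by `Q` itself; it depends
only on the quantizers that `Q` uses before time `t`. -/
def UsesBeliefs (S : Source P X Y W R m d) (Q : Encoder Y M) : Prop :=
  ∃ q : ∀ t : ℕ, ProbabilityMeasure (ProbabilityMeasure (Fin (memLen m d) → X)) →
      ProbabilityMeasure (Fin (memLen m d) → X) → Fin (M t),
    (∀ t, Measurable (Function.uncurry (q t))) ∧
    ∀ t y h, Q.toFun t y h = q t (S.beliefOnBelief Q t h) (S.belief t y)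

end Belief

/-- The expected cost `E[∑_{t<T} c(z_t, v_t)]` of a composite policy and a receiver policy. -/
def cost (S : Source P X Y W R m d) (c : (Fin (memLen m d) → X) → U → ℝ) (T : ℕ)
    (Q : Encoder Y M) (γ : Receiver M U) : ℝ :=
  ∫ ω, ∑ t ∈ Finset.range T, c (S.state t ω) (γ t (S.outputs Q (t + 1) ω)) ∂P

/-- The performance of a composite policy: the infimum of the cost over the receiver policies. -/
def value (S : Source P X Y W R m d) (c : (Fin (memLen m d) → X) → U → ℝ) (T : ℕ)
    (Q : Encoder Y M) : ℝ :=
  ⨅ γ : Receiver M U, S.cost c T Q γ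

/-- `Q` is an optimal composite policy: it minimizes the performance. -/
def IsOptimal (S : Source P X Y W R m d) (c : (Fin (memLen m d) → X) → U → ℝ) (T : ℕ)
    (Q : Encoder Y M) : Prop :=
  ∀ Q' : Encoder Y M, S.value c T Q ≤ S.value c T Q'

/-- Replacing `Q` by `Q'` causes no loss in performance: whatever receiver `Q` is used with, some
receiver makes `Q'` at least as good. -/
def NoLoss (S : Source P X Y W R m d) (c : (Fin (memLen m d) → X) → U → ℝ) (T : ℕ)
    (Q Q' : Encoder Y M) : Prop :=
  ∀ γ : Receiver M U, ∃ γ' : Receiver M U, S.cost c T Q' γ' ≤ S.cost c T Q γ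

end Source

end CausalCoding

end

/-! The beliefs `π_t` form a Markov chain with respect to the observations: `π_{t+1}` is a Bayes
update of `π_t` by `y_{t+1}`, whose law given `y_{[0,t]}` depends on `π_t` alone (`pathBelief_succ`,
`lintegral_obs_pathBelief_succ`). So if all decisions after time `t` use only beliefs and outputs,
the cost from `t` on is the expectation of a function of `(π_t, q_{[0,t-1]}, q_t)`, and only the
joint law of this triple matters.

For (i), the decision at `t` may therefore be redrawn from the conditional law of `q_t` given `(π_t,
q_{[0,t-1]})`. A uniform variable `u` realizes this randomization (`exists_mixture`), and some fixed
value of `u` does no worse than the average. Backward induction from the horizon treats every time.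
To have one encoder serve all receivers, `u` is chosen by `exists_forall_exists_le_of_lintegral_le`.

For (ii), the cost from `t` on after a history `h` depends on `h` only through the conditional law
`Ξ_t` of `π_t` and through the continuation prescribed after `h`. There are finitely many histories,
so for each value of `Ξ_t` one continuation is best; every history with that value is made to follow
it (`exists_usesBeliefsBefore_succ`). This runs forward in time, because `Ξ_t` is determined by the
earlier quantizers, which are then already settled. -/

noncomputable section

namespace CausalCoding

/-! ### Regrouping of independent variables and integration against conditional laws. -/

section Independence

variable {Ω α β γ δ : Type*} [MeasurableSpace Ω] {P : Measure Ω} [IsProbabilityMeasure P]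
  [MeasurableSpace α] [MeasurableSpace β] [MeasurableSpace γ] [MeasurableSpace δ]

lemma indepFun_prodMk_of_prodMk {A : Ω → α} {B : Ω → β} {C : Ω → γ} (hA : Measurable A)
    (hB : Measurable B) (hC : Measurable C) (h : IndepFun A B P)
    (h' : IndepFun (fun ω => (A ω, B ω)) C P) : IndepFun A (fun ω => (B ω, C ω)) P := by
  have hBC : IndepFun B C P := h'.comp (φ := Prod.snd) (ψ := id) measurable_snd measurable_id
  rw [indepFun_iff_map_prod_eq_prod_map_map (by fun_prop) (by fun_prop)] at h h' hBC ⊢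
  rw [hBC, ← Measure.prodAssoc_prod, ← h, ← h', Measure.map_map (by fun_prop) (by fun_prop)]
  rfl

lemma indepFun_prodMk_prodMk {A : Ω → α} {B : Ω → β} {C : Ω → γ} {D : Ω → δ} (hA : Measurable A)
    (hB : Measurable B) (hC : Measurable C) (hD : Measurable D) (hAB : IndepFun A B P)
    (hCD : IndepFun C D P) (h : IndepFun (fun ω => (A ω, B ω)) (fun ω => (C ω, D ω)) P) :
    IndepFun (fun ω => (A ω, C ω)) (fun ω => (B ω, D ω)) P := by
  have hB' : IndepFun (fun ω => (C ω, D ω)) B P :=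
    (h.comp (φ := Prod.snd) (ψ := id) measurable_snd measurable_id).symm
  have h1 := indepFun_prodMk_of_prodMk hC hD hB hCD hB'
  have h2 := indepFun_prodMk_of_prodMk hA hB (hC.prodMk hD) hAB h
  have h3 : IndepFun (fun ω => (D ω, B ω)) C P := h1.symm
  have h4 : IndepFun (fun ω => ((D ω, B ω), C ω)) A P :=
    (h2.comp (φ := id) (ψ := fun p : β × (γ × δ) => ((p.2.2, p.1), p.2.1)) measurable_id
      (by fun_prop)).symm
  have h5 := indepFun_prodMk_of_prodMk (hD.prodMk hB) hC hA h3 h4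
  exact (h5.comp (φ := fun p : δ × β => (p.2, p.1)) (ψ := fun p : γ × α => (p.2, p.1))
    (by fun_prop) (by fun_prop)).symm

lemma lintegral_comp_prodMk_of_indepFun {A : Ω → α} {B : Ω → β} (hA : Measurable A)
    (hB : Measurable B) (h : IndepFun A B P) {F : α → β → ENNReal}
    (hF : Measurable (Function.uncurry F)) :
    ∫⁻ ω, F (A ω) (B ω) ∂P = ∫⁻ ω, ∫⁻ b, F (A ω) b ∂(P.map B) ∂P := by
  rw [indepFun_iff_map_prod_eq_prod_map_map hA.aemeasurable hB.aemeasurable] at h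
  have := Measure.isProbabilityMeasure_map (μ := P) hB.aemeasurable
  calc ∫⁻ ω, F (A ω) (B ω) ∂P = ∫⁻ p, Function.uncurry F p ∂(P.map fun ω => (A ω, B ω)) := by
        rw [lintegral_map hF (by fun_prop)]; rfl
    _ = ∫⁻ ω, ∫⁻ b, F (A ω) b ∂(P.map B) ∂P := by
        rw [h, lintegral_prod _ hF.aemeasurable, lintegral_map hF.lintegral_prod_right' hA]
        rfl

lemma lintegral_condDistrib [StandardBorelSpace β] [Nonempty β] {A : Ω → α} {B : Ω → β}
    (hA : Measurable A) (hB : Measurable B) {F : α → β → ENNReal}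
    (hF : Measurable (Function.uncurry F)) :
    ∫⁻ ω, F (A ω) (B ω) ∂P = ∫⁻ ω, ∫⁻ b, F (A ω) b ∂(condDistrib B A P (A ω)) ∂P := by
  calc ∫⁻ ω, F (A ω) (B ω) ∂P = ∫⁻ p, Function.uncurry F p ∂(P.map fun ω => (A ω, B ω)) := by
        rw [lintegral_map hF (hA.prodMk hB)]; rfl
    _ = _ := by
        rw [← compProd_map_condDistrib hB.aemeasurable, Measure.lintegral_compProd hF,
          lintegral_map hF.lintegral_kernel_prod_right' hA]
        rfl

end Independence

/-! ### Selection of one index for all receivers, and measurable interpolation. -/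

/-- The upper sets generated by the values of `f a` are totally ordered by inclusion, so a maximal
one among finitely many is the largest. Comparing upper sets rather than infima covers infima that
are not attained. -/
lemma exists_forall_exists_le {α Γ : Type*} [Finite α] [Nonempty α] (f : α → Γ → ENNReal) :
    ∃ a, ∀ b γ, ∃ γ', f a γ' ≤ f b γ := by
  obtain ⟨a, -, ha⟩ := Set.Finite.exists_maximalFor
    (fun a => {x : ENNReal | ∃ γ', f a γ' ≤ x}) _ Set.finite_univ
    Set.univ_nonempty
  refine ⟨a, fun b γ => ?_⟩
  by_contra! h
  have hab : {x : ENNReal | ∃ γ', f a γ' ≤ x} ⊆ {x : ENNReal | ∃ γ', f b γ' ≤ x} := by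
    rintro x ⟨γ', hx⟩
    exact ⟨γ, (h γ').le.trans hx⟩
  obtain ⟨γ', hγ'⟩ := ha (Set.mem_univ b) hab (show f b γ ∈ _ from ⟨γ, le_rfl⟩)
  exact absurd hγ' (h γ').not_ge

/-- If the averages over `u` of the costs `J u γ` are at most `F γ`, then a single `u` does at least
as well as `F`, in that each `F γ` is dominated by some `J u γ'`. -/
lemma exists_forall_exists_le_of_lintegral_le {I Γ : Type*} [MeasurableSpace I] {μ : Measure I}
    [IsProbabilityMeasure μ] {J : I → Γ → ENNReal} {F : Γ → ENNReal}
    (hJ : ∀ γ, Measurable fun u => J u γ) (h : ∀ γ, ∫⁻ u, J u γ ∂μ ≤ F γ) :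
    ∃ u, ∀ γ, ∃ γ', J u γ' ≤ F γ := by
  rcases isEmpty_or_nonempty Γ with hΓ | hΓ
  · exact ⟨(nonempty_of_isProbabilityMeasure μ).some, fun γ => hΓ.elim γ⟩
  -- If `F` attains its minimum at `γ₀`, a `u` that is good for `γ₀` is good for every `γ`.
  -- Otherwise `inf F < F γ` for every `γ`, and this strict gap lets a minimizing sequence replace
  -- the minimizer.
  by_cases hmin : ∃ γ₀, ∀ γ, F γ₀ ≤ F γ
  · obtain ⟨γ₀, hγ₀⟩ := hmin
    obtain ⟨u, hu⟩ := exists_le_lintegral (hJ γ₀).aemeasurable (μ := μ)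
    exact ⟨u, fun γ => ⟨γ₀, (hu.trans (h γ₀)).trans (hγ₀ γ)⟩⟩
  · push Not at hmin
    obtain ⟨g, -, hg, hgF⟩ := exists_seq_tendsto_sInf (Set.range_nonempty F) (OrderBot.bddBelow _)
    choose k hk using hgF
    have hmeas : Measurable fun u => ⨅ n, J u (k n) := Measurable.iInf fun n => hJ (k n)
    obtain ⟨u, hu⟩ := exists_le_lintegral hmeas.aemeasurable (μ := μ)
    have hle : ⨅ n, J u (k n) ≤ sInf (Set.range F) := by
      refine hu.trans (ge_of_tendsto' hg fun n => ?_)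
      rw [← hk n]
      exact (lintegral_mono fun u => iInf_le _ n).trans (h (k n))
    refine ⟨u, fun γ => ?_⟩
    obtain ⟨γ₁, hγ₁⟩ := hmin γ
    have hlt : ⨅ n, J u (k n) < F γ :=
      (hle.trans (sInf_le (Set.mem_range_self γ₁))).trans_lt hγ₁
    obtain ⟨n, hn⟩ := iInf_lt_iff.1 hlt
    exact ⟨k n, hn.le⟩

/-- Evaluations on measurable sets separate measures. This allows interpolation at the finitely many
values of `Ξ_t`. -/
lemma separatesPoints_probabilityMeasure {α : Type*} [MeasurableSpace α] :
    MeasurableSpace.SeparatesPoints (ProbabilityMeasure α) where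
  separates μ ν h := by
    refine Subtype.ext (Measure.ext fun A hA => ?_)
    have hm : MeasurableSet {ρ : ProbabilityMeasure α | (ρ : Measure α) A = (μ : Measure α) A} :=
      ((Measure.measurable_coe hA).comp measurable_subtype_coe) (measurableSet_singleton _)
    exact (h _ hm rfl).symm

/-- Functions on a finite set of points can be interpolated measurably. -/
lemma exists_measurable_interpolation {ι α β : Type*} [Finite ι] [MeasurableSpace α]
    [MeasurableSpace.SeparatesPoints α] [MeasurableSpace β] [Nonempty β] (ξ : ι → α) (F : α → β) :
    ∃ e : α → β, Measurable e ∧ ∀ i, e (ξ i) = F (ξ i) := by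
  classical
  suffices H : ∀ s : Finset α, ∃ e : α → β, Measurable e ∧ ∀ x ∈ s, e x = F x by
    obtain ⟨e, he, h⟩ := H (Set.finite_range ξ).toFinset
    exact ⟨e, he, fun i => h _ (by simp)⟩
  intro s
  induction s using Finset.induction_on with
  | empty => exact ⟨fun _ => Classical.arbitrary β, measurable_const, by simp⟩
  | insert a s ha ih =>
    obtain ⟨e, he, h⟩ := ih
    -- The intersection of these sets contains `a` and no earlier point, so changing `e` on it
    -- leaves the earlier values intact.
    have hsep : ∀ x : s, ∃ A, MeasurableSet A ∧ a ∈ A ∧ (x : α) ∉ A := fun x =>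
      MeasurableSpace.exists_measurableSet_of_ne fun hax => ha (hax ▸ x.2)
    choose A hA haA hxA using hsep
    have hm : MeasurableSet (⋂ x, A x) := MeasurableSet.iInter hA
    refine ⟨(⋂ x, A x).piecewise (fun _ => F a) e, Measurable.piecewise hm measurable_const he, ?_⟩
    intro x hx
    rcases Finset.mem_insert.1 hx with rfl | hx
    · exact Set.piecewise_eq_of_mem _ _ _ (Set.mem_iInter.2 haA)
    · rw [Set.piecewise_eq_of_notMem, h x hx]
      exact fun hmem => hxA ⟨x, hx⟩ (Set.mem_iInter.1 hmem ⟨x, hx⟩)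

end CausalCoding

/-! ### State dynamics and independence of the fresh noise. -/

namespace CausalCoding

namespace Source

variable {Ω X Y W R U : Type*} [MeasurableSpace Ω] {P : Measure Ω}
  [MeasurableSpace X] [MeasurableSpace Y] [MeasurableSpace W] [MeasurableSpace R]
  {m d : ℕ} {M : ℕ → ℕ}

/-- The update of the augmented state. -/
def step (S : Source P X Y W R m d) (p : (Fin (memLen m d) → X) × W) : Fin (memLen m d) → X :=
  fun i => if h : (i : ℕ) + 1 < memLen m d then p.1 ⟨i + 1, h⟩
    -- The newest symbol depends on the last `m` entries of the window, which has length at least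
    -- `m`; hence `z_t` is Markov.
    else S.f (fun j : Fin m => p.1 ⟨memLen m d - m + j, by
      have := j.2; simp only [memLen]; omega⟩, p.2)

lemma measurable_step (S : Source P X Y W R m d) : Measurable S.step := by
  refine measurable_pi_lambda _ fun i => ?_
  by_cases h : (i : ℕ) + 1 < memLen m d
  · simp only [step, h, dite_true]
    fun_prop
  · simp only [step, h, dite_false]
    exact S.measurable_f.comp (by fun_prop)

lemma state_succ (S : Source P X Y W R m d) (t : ℕ) (ω : Ω) :
    S.state (t + 1) ω = S.step (S.state t ω, S.w t ω) := by
  funext i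
  have hm : m ≤ memLen m d := le_max_right _ _
  by_cases h : (i : ℕ) + 1 < memLen m d
  · simp only [step, h, dite_true, state, window]
    congr 1
    push_cast
    ring
  · have hi : (i : ℕ) + 1 = memLen m d := by have := i.2; omega
    simp only [step, h, dite_false, state, window]
    rw [show ((t + 1 : ℕ) : ℤ) - (memLen m d : ℕ) + 1 + (i : ℕ) = t + 1 by omega, S.source_eq]
    congr 2
    funext j
    simp only [window]
    congr 1
    push_cast [Nat.cast_sub hm]
    ring

lemma obs_succ (S : Source P X Y W R m d) (t : ℕ) (ω : Ω) :
    S.obs (t + 1) ω = Fin.snoc (α := fun _ => Y) (S.obs t ω) (S.y (t + 1) ω) := by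
  funext i
  refine Fin.lastCases ?_ (fun j => ?_) i
  · simp [obs]
  · simp [obs]

lemma measurable_snoc_const (n : ℕ) :
    Measurable fun p : (Fin n → Y) × Y => (Fin.snoc (α := fun _ => Y) p.1 p.2 : Fin (n + 1) → Y) := by
  refine measurable_pi_lambda _ fun i => ?_
  refine Fin.lastCases ?_ (fun j => ?_) i
  · simpa using measurable_snd
  · simp only [Fin.snoc_castSucc]
    fun_prop

/-- The index ranges are the point: only `w_0, …, w_{t-1}` and `r_0, …, r_t` enter, so `w_t` and
`r_{t+1}` are still fresh. -/
lemma exists_obs_state_eq (S : Source P X Y W R m d) (t : ℕ) :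
    ∃ φ : (Fin (memLen m d) → X) × ((Fin t → W) × (Fin (t + 1) → R)) →
        (Fin (t + 1) → Y) × (Fin (memLen m d) → X),
      Measurable φ ∧ ∀ ω, (S.obs t ω, S.state t ω) =
        φ (S.state 0 ω, (fun i => S.w i ω, fun i => S.r i ω)) := by
  induction t with
  | zero =>
    refine ⟨fun p => (fun _ => S.g (p.1, p.2.2 0), p.1), ?_, fun ω => ?_⟩
    · exact (measurable_pi_lambda _ fun _ => S.measurable_g.comp (by fun_prop)).prodMk measurable_fst
    · refine Prod.ext (funext fun i => ?_) rfl
      obtain rfl : i = 0 := Fin.fin_one_eq_zero i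
      exact S.obs_eq 0 ω
  | succ t ih =>
    obtain ⟨φ, hφ, h⟩ := ih
    let z : (Fin (memLen m d) → X) × ((Fin (t + 1) → W) × (Fin (t + 2) → R)) →
        (Fin (t + 1) → Y) × (Fin (memLen m d) → X) := fun p =>
      φ (p.1, (fun i => p.2.1 i.castSucc, fun i => p.2.2 i.castSucc))
    have hz : Measurable z := hφ.comp (by fun_prop)
    have hs : Measurable fun p : (Fin (memLen m d) → X) × ((Fin (t + 1) → W) × (Fin (t + 2) → R)) =>
        S.step ((z p).2, p.2.1 (Fin.last t)) :=
      S.measurable_step.comp ((measurable_snd.comp hz).prodMk (by fun_prop))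
    refine ⟨fun p => (Fin.snoc (α := fun _ => Y) (z p).1
        (S.g (S.step ((z p).2, p.2.1 (Fin.last t)), p.2.2 (Fin.last (t + 1)))),
      S.step ((z p).2, p.2.1 (Fin.last t))), ?_, fun ω => ?_⟩
    · refine Measurable.prodMk ((measurable_snoc_const (t + 1)).comp
        ((measurable_fst.comp hz).prodMk (S.measurable_g.comp (hs.prodMk (by fun_prop))))) hs
    · have hzω : z (S.state 0 ω, (fun i => S.w i ω, fun i => S.r i ω)) =
          (S.obs t ω, S.state t ω) := (h ω).symm
      have hy := S.obs_eq (t + 1) ω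
      simp only [hzω, obs_succ, state_succ]
      change S.y (t + 1) ω = S.g (S.state (t + 1) ω, S.r (t + 1) ω) at hy
      rw [hy, state_succ]
      rfl

/-- The next observation and state, as a function of the present state and the noises. -/
def transition (S : Source P X Y W R m d) (p : (Fin (memLen m d) → X) × (W × R)) :
    Y × (Fin (memLen m d) → X) :=
  (S.g (S.step (p.1, p.2.1), p.2.2), S.step (p.1, p.2.1))

lemma measurable_transition (S : Source P X Y W R m d) : Measurable S.transition := by
  have h : Measurable fun p : (Fin (memLen m d) → X) × (W × R) => S.step (p.1, p.2.1) :=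
    S.measurable_step.comp (by fun_prop)
  exact (S.measurable_g.comp (h.prodMk (by fun_prop))).prodMk h

lemma transition_eq (S : Source P X Y W R m d) (t : ℕ) (ω : Ω) :
    S.transition (S.state t ω, (S.w t ω, S.r (t + 1) ω)) = (S.y (t + 1) ω, S.state (t + 1) ω) := by
  have hy := S.obs_eq (t + 1) ω
  change S.y (t + 1) ω = S.g (S.state (t + 1) ω, S.r (t + 1) ω) at hy
  rw [hy, state_succ]
  rfl

lemma indepFun_initial_noise (S : Source P X Y W R m d) :
    IndepFun (S.state 0)
      (fun ω => ((fun t => S.w t ω, fun t => S.r t ω) : (ℕ → W) × (ℕ → R))) P :=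
  S.indep_init

variable [IsProbabilityMeasure P]

/-- The noises that drive the transition after time `t` are independent of the past. -/
lemma indepFun_obs_state_noise (S : Source P X Y W R m d) (t : ℕ) :
    IndepFun (fun ω => (S.obs t ω, S.state t ω)) (fun ω => (S.w t ω, S.r (t + 1) ω)) P := by
  obtain ⟨φ, hφ, h⟩ := S.exists_obs_state_eq t
  have hw := S.measurable_w
  have hr := S.measurable_r
  have hw' : IndepFun (S.w t) (fun ω (i : Fin t) => S.w i ω) P := by
    have := S.indep_w.indepFun_finset {t} (Finset.range t) (by simp) S.measurable_w
    exact this.comp (φ := fun f : ({t} : Finset ℕ) → W => f ⟨t, by simp⟩)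
      (ψ := fun (f : Finset.range t → W) (i : Fin t) => f ⟨i, by simp⟩)
      (by fun_prop) (by fun_prop)
  have hr' : IndepFun (S.r (t + 1)) (fun ω (i : Fin (t + 1)) => S.r i ω) P := by
    have := S.indep_r.indepFun_finset {t + 1} (Finset.range (t + 1)) (by simp) S.measurable_r
    exact this.comp (φ := fun f : ({t + 1} : Finset ℕ) → R => f ⟨t + 1, by simp⟩)
      (ψ := fun (f : Finset.range (t + 1) → R) (i : Fin (t + 1)) => f ⟨i, Finset.mem_range.2 i.2⟩)
      (by fun_prop) (by fun_prop)
  have hwr : IndepFun (fun ω => (S.w t ω, fun i : Fin t => S.w i ω))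
      (fun ω => (S.r (t + 1) ω, fun i : Fin (t + 1) => S.r i ω)) P :=
    S.indep_w_r.comp (φ := fun f => (f t, fun i : Fin t => f i))
      (ψ := fun f => (f (t + 1), fun i : Fin (t + 1) => f i)) (by fun_prop) (by fun_prop)
  have h1 := indepFun_prodMk_prodMk (hw t) (measurable_pi_lambda _ fun i : Fin t => hw i)
    (hr (t + 1)) (measurable_pi_lambda _ fun i : Fin (t + 1) => hr i) hw' hr' hwr
  have h2 : IndepFun (fun ω => ((S.w t ω, S.r (t + 1) ω),
      ((fun i : Fin t => S.w i ω), fun i : Fin (t + 1) => S.r i ω))) (S.state 0) P :=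
    (S.indepFun_initial_noise.comp (φ := id)
      (ψ := fun f => ((f.1 t, f.2 (t + 1)), ((fun i : Fin t => f.1 i),
        fun i : Fin (t + 1) => f.2 i))) measurable_id (by fun_prop)).symm
  have h3 := indepFun_prodMk_of_prodMk ((hw t).prodMk (hr (t + 1)))
    ((measurable_pi_lambda _ fun i : Fin t => hw i).prodMk
      (measurable_pi_lambda _ fun i : Fin (t + 1) => hr i)) (S.measurable_state 0) h1 h2
  have h4 := h3.comp (φ := id) (ψ := fun p => φ (p.2, p.1)) measurable_id (by fun_prop)
  rw [show (fun ω => (S.obs t ω, S.state t ω)) = fun ω =>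
    φ (S.state 0 ω, (fun i => S.w i ω, fun i => S.r i ω)) from funext h]
  exact h4.symm

/-- The law of the noises that drive the transition after time `t`. -/
def noiseLaw (S : Source P X Y W R m d) (t : ℕ) : Measure (W × R) :=
  P.map fun ω => (S.w t ω, S.r (t + 1) ω)

instance (S : Source P X Y W R m d) (t : ℕ) : IsProbabilityMeasure (S.noiseLaw t) :=
  Measure.isProbabilityMeasure_map
    ((S.measurable_w t).prodMk (S.measurable_r (t + 1))).aemeasurable

/-- The conditional law of `(y_{t+1}, z_{t+1})` given `z_t`. -/
def transitionKernel (S : Source P X Y W R m d) (t : ℕ) :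
    Kernel (Fin (memLen m d) → X) (Y × (Fin (memLen m d) → X)) :=
  (Kernel.id ×ₖ Kernel.const _ (S.noiseLaw t)).map S.transition

instance (S : Source P X Y W R m d) (t : ℕ) : IsMarkovKernel (S.transitionKernel t) := by
  unfold transitionKernel
  exact Kernel.IsMarkovKernel.map _ S.measurable_transition

lemma lintegral_transitionKernel (S : Source P X Y W R m d) (t : ℕ) (z : Fin (memLen m d) → X)
    {F : Y × (Fin (memLen m d) → X) → ENNReal} (hF : Measurable F) :
    ∫⁻ p, F p ∂(S.transitionKernel t z) = ∫⁻ e, F (S.transition (z, e)) ∂(S.noiseLaw t) := by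
  have hFT : Measurable fun p => F (S.transition p) := hF.comp S.measurable_transition
  rw [transitionKernel, Kernel.map_apply _ S.measurable_transition, lintegral_map hF S.measurable_transition,
    Kernel.prod_apply, Kernel.id_apply, Kernel.const_apply, lintegral_prod _
      hFT.aemeasurable, lintegral_dirac' _ hFT.lintegral_prod_right']

/-! ### Prediction from the current belief. -/

section Filter

variable [TopologicalSpace X] [PolishSpace X] [BorelSpace X] [Nonempty X]

/-- The belief `π_t` along the sample path. -/
def pathBelief (S : Source P X Y W R m d) (t : ℕ) (ω : Ω) :
    ProbabilityMeasure (Fin (memLen m d) → X) := S.belief t (S.obs t ω)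

lemma measurable_pathBelief (S : Source P X Y W R m d) (t : ℕ) : Measurable (S.pathBelief t) :=
  S.measurable_belief_obs t

lemma lintegral_obs_state (S : Source P X Y W R m d) (t : ℕ)
    {F : (Fin (t + 1) → Y) → (Fin (memLen m d) → X) → ENNReal}
    (hF : Measurable (Function.uncurry F)) :
    ∫⁻ ω, F (S.obs t ω) (S.state t ω) ∂P =
      ∫⁻ ω, ∫⁻ z, F (S.obs t ω) z ∂(S.pathBelief t ω : Measure (Fin (memLen m d) → X)) ∂P :=
  lintegral_condDistrib (S.measurable_obs t) (S.measurable_state t) hF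

/-- The map that sends a belief to itself, as a kernel. -/
def beliefKernel (m d : ℕ) (X : Type*) [MeasurableSpace X] :
    Kernel (ProbabilityMeasure (Fin (memLen m d) → X)) (Fin (memLen m d) → X) where
  toFun π := (π : Measure (Fin (memLen m d) → X))
  measurable' := measurable_subtype_coe

instance : IsMarkovKernel (beliefKernel m d X) := ⟨fun π => π.2⟩

/-- The conditional law of `(y_{t+1}, z_{t+1})` given `y_{[0,t]}`, as a function of `π_t`. -/
def predictionKernel (S : Source P X Y W R m d) (t : ℕ) :
    Kernel (ProbabilityMeasure (Fin (memLen m d) → X)) (Y × (Fin (memLen m d) → X)) :=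
  S.transitionKernel t ∘ₖ beliefKernel m d X

instance (S : Source P X Y W R m d) (t : ℕ) : IsMarkovKernel (S.predictionKernel t) := by
  unfold predictionKernel; infer_instance

/-- The fresh noise is integrated out first, by independence from the past; then `z_t` is integrated
against `π_t`. -/
lemma lintegral_obs_next (S : Source P X Y W R m d) (t : ℕ)
    {F : (Fin (t + 1) → Y) → Y × (Fin (memLen m d) → X) → ENNReal}
    (hF : Measurable (Function.uncurry F)) :
    ∫⁻ ω, F (S.obs t ω) (S.y (t + 1) ω, S.state (t + 1) ω) ∂P =
      ∫⁻ ω, ∫⁻ p, F (S.obs t ω) p ∂(S.predictionKernel t (S.pathBelief t ω)) ∂P := by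
  have hT := S.measurable_transition
  have hG : Measurable (Function.uncurry fun (a : (Fin (t + 1) → Y) × (Fin (memLen m d) → X))
      (e : W × R) => F a.1 (S.transition (a.2, e))) :=
    hF.comp (g := Function.uncurry F)
      (f := fun a : ((Fin (t + 1) → Y) × (Fin (memLen m d) → X)) × (W × R) =>
        (a.1.1, S.transition (a.1.2, a.2))) (by fun_prop)
  have h := lintegral_comp_prodMk_of_indepFun ((S.measurable_obs t).prodMk (S.measurable_state t))
    ((S.measurable_w t).prodMk (S.measurable_r (t + 1))) (S.indepFun_obs_state_noise t) hG
  simp only [transition_eq] at h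
  change _ = ∫⁻ ω, ∫⁻ e, F (S.obs t ω) (S.transition (S.state t ω, e)) ∂(S.noiseLaw t) ∂P at h
  rw [h, S.lintegral_obs_state t (F := fun o z => ∫⁻ e, F o (S.transition (z, e)) ∂(S.noiseLaw t))]
  · refine lintegral_congr fun ω => ?_
    have hFo : Measurable (F (S.obs t ω)) := hF.of_uncurry_left
    rw [predictionKernel, Kernel.lintegral_comp _ _ _ hFo]
    exact lintegral_congr fun z => (S.lintegral_transitionKernel t z hFo).symm
  · exact hG.lintegral_prod_right'

end Filter

end Source

end CausalCoding

/-! ### Bayes recursion and Markov property of the beliefs. -/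

namespace CausalCoding

namespace Source

variable {Ω X Y W R U : Type*} [MeasurableSpace Ω] {P : Measure Ω}
  [MeasurableSpace X] [MeasurableSpace Y] [MeasurableSpace W] [MeasurableSpace R]
  {m d : ℕ} {M : ℕ → ℕ}
  [IsProbabilityMeasure P] [TopologicalSpace X] [PolishSpace X] [BorelSpace X] [Nonempty X]
  [MeasurableSpace.CountablyGenerated Y]

/-- The Bayes update of the belief at time `t` by the observation at time `t + 1`. -/
def beliefUpdate (S : Source P X Y W R m d) (t : ℕ)
    (p : ProbabilityMeasure (Fin (memLen m d) → X) × Y) :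
    ProbabilityMeasure (Fin (memLen m d) → X) :=
  ⟨(S.predictionKernel t).condKernel p, inferInstance⟩

lemma measurable_beliefUpdate (S : Source P X Y W R m d) (t : ℕ) :
    Measurable (S.beliefUpdate t) :=
  (Kernel.measurable _).subtype_mk

lemma lintegral_predictionKernel (S : Source P X Y W R m d) (t : ℕ)
    (π : ProbabilityMeasure (Fin (memLen m d) → X)) {F : Y × (Fin (memLen m d) → X) → ENNReal}
    (hF : Measurable F) :
    ∫⁻ p, F p ∂(S.predictionKernel t π) =
      ∫⁻ p, ∫⁻ z, F (p.1, z) ∂(S.beliefUpdate t (π, p.1) : Measure (Fin (memLen m d) → X))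
        ∂(S.predictionKernel t π) := by
  have hG : Measurable fun p : (ProbabilityMeasure (Fin (memLen m d) → X) × Y) ×
      (Fin (memLen m d) → X) => F (p.1.2, p.2) := by fun_prop
  have h1 : Measurable fun y => ∫⁻ z, F (y, z) ∂((S.predictionKernel t).condKernel (π, y)) :=
    (hG.lintegral_kernel_prod_right' (κ := (S.predictionKernel t).condKernel)).comp
      (measurable_prodMk_left (x := π))
  conv_lhs => rw [← (S.predictionKernel t).disintegrate (S.predictionKernel t).condKernel]
  rw [Kernel.lintegral_compProd _ _ _ hF, Kernel.lintegral_fst _ _ h1]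
  rfl

/-- By almost sure uniqueness of conditional laws, it is enough that the Bayes update disintegrates
the joint law of `(y_{[0,t+1]}, z_{t+1})`. Conditioning on `y_{[0,t]}` reduces this to the
disintegration of `predictionKernel` along `y_{t+1}`. -/
lemma pathBelief_succ (S : Source P X Y W R m d) (t : ℕ) :
    ∀ᵐ ω ∂P, S.pathBelief (t + 1) ω = S.beliefUpdate t (S.pathBelief t ω, S.y (t + 1) ω) := by
  let b : (Fin (t + 2) → Y) → ProbabilityMeasure (Fin (memLen m d) → X) × Y :=
    fun v => (S.belief t (fun i => v i.castSucc), v (Fin.last (t + 1)))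
  have hb : Measurable b :=
    ((S.measurable_belief t).comp (by fun_prop)).prodMk (measurable_pi_apply _)
  have hbω : ∀ ω, b (S.obs (t + 1) ω) = (S.pathBelief t ω, S.y (t + 1) ω) := fun ω => rfl
  let κ : Kernel (Fin (t + 2) → Y) (Fin (memLen m d) → X) :=
    (S.predictionKernel t).condKernel.comap b hb
  have key : condDistrib (S.state (t + 1)) (S.obs (t + 1)) P
      =ᵐ[P.map (S.obs (t + 1))] κ := by
    refine condDistrib_ae_eq_of_measure_eq_compProd (S.obs (t + 1))
      (S.measurable_state (t + 1)).aemeasurable ?_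
    refine Measure.ext_of_lintegral _ fun F hF => ?_
    have hF' : Measurable (Function.uncurry fun (o : Fin (t + 1) → Y)
        (p : Y × (Fin (memLen m d) → X)) => F (Fin.snoc (α := fun _ => Y) o p.1, p.2)) :=
      hF.comp (((measurable_snoc_const (t + 1)).comp (by fun_prop :
        Measurable fun q : (Fin (t + 1) → Y) × (Y × (Fin (memLen m d) → X)) => (q.1, q.2.1))).prodMk
          (by fun_prop))
    have hG : Measurable fun v => ∫⁻ z, F (v, z) ∂(κ v) := hF.lintegral_kernel_prod_right'
    have hbs : ∀ (o : Fin (t + 1) → Y) (y : Y),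
        b (Fin.snoc (α := fun _ => Y) o y) = (S.belief t o, y) := fun o y => by simp [b]
    have hG' : Measurable (Function.uncurry fun (o : Fin (t + 1) → Y)
        (p : Y × (Fin (memLen m d) → X)) =>
          ∫⁻ z, F (Fin.snoc (α := fun _ => Y) o p.1, z) ∂(κ (Fin.snoc (α := fun _ => Y) o p.1))) :=
      hG.comp ((measurable_snoc_const (t + 1)).comp (by fun_prop :
        Measurable fun q : (Fin (t + 1) → Y) × (Y × (Fin (memLen m d) → X)) => (q.1, q.2.1)))
    rw [lintegral_map hF ((S.measurable_obs (t + 1)).prodMk (S.measurable_state (t + 1))),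
      Measure.lintegral_compProd hF, lintegral_map hG (S.measurable_obs (t + 1))]
    simp only [obs_succ]
    rw [S.lintegral_obs_next t hF', S.lintegral_obs_next t hG']
    refine lintegral_congr fun ω => ?_
    rw [S.lintegral_predictionKernel t _ hF'.of_uncurry_left]
    refine lintegral_congr fun p => ?_
    simp only [κ, Kernel.comap_apply, hbs]
    rfl
  filter_upwards [ae_of_ae_map (S.measurable_obs (t + 1)).aemeasurable key] with ω hω
  refine Subtype.ext ?_
  change condDistrib (S.state (t + 1)) (S.obs (t + 1)) P (S.obs (t + 1) ω) = _
  rw [hω]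
  simp only [κ, Kernel.comap_apply, hbω]
  rfl

/-- The conditional law of `π_{t+1}` given `y_{[0,t]}`, as a function of `π_t`. -/
def beliefTransition (S : Source P X Y W R m d) (t : ℕ) :
    Kernel (ProbabilityMeasure (Fin (memLen m d) → X))
      (ProbabilityMeasure (Fin (memLen m d) → X)) :=
  (Kernel.id ×ₖ (S.predictionKernel t).fst).map (S.beliefUpdate t)

instance (S : Source P X Y W R m d) (t : ℕ) : IsMarkovKernel (S.beliefTransition t) := by
  unfold beliefTransition
  exact Kernel.IsMarkovKernel.map _ (S.measurable_beliefUpdate t)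

lemma lintegral_beliefTransition (S : Source P X Y W R m d) (t : ℕ)
    (π : ProbabilityMeasure (Fin (memLen m d) → X))
    {F : ProbabilityMeasure (Fin (memLen m d) → X) → ENNReal} (hF : Measurable F) :
    ∫⁻ π', F π' ∂(S.beliefTransition t π) =
      ∫⁻ p, F (S.beliefUpdate t (π, p.1)) ∂(S.predictionKernel t π) := by
  have hFT : Measurable fun p => F (S.beliefUpdate t p) := hF.comp (S.measurable_beliefUpdate t)
  rw [beliefTransition, Kernel.map_apply _ (S.measurable_beliefUpdate t),
    lintegral_map hF (S.measurable_beliefUpdate t),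
    Kernel.prod_apply, Kernel.id_apply, lintegral_prod _ hFT.aemeasurable,
    lintegral_dirac' _ hFT.lintegral_prod_right',
    Kernel.lintegral_fst _ _ (g := fun y => F (S.beliefUpdate t (π, y)))
      (hFT.comp measurable_prodMk_left)]

/-- The beliefs form a Markov chain with respect to the observations. -/
lemma lintegral_obs_pathBelief_succ (S : Source P X Y W R m d) (t : ℕ)
    {F : (Fin (t + 1) → Y) → ProbabilityMeasure (Fin (memLen m d) → X) → ENNReal}
    (hF : Measurable (Function.uncurry F)) :
    ∫⁻ ω, F (S.obs t ω) (S.pathBelief (t + 1) ω) ∂P =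
      ∫⁻ ω, ∫⁻ π, F (S.obs t ω) π ∂(S.beliefTransition t (S.pathBelief t ω)) ∂P := by
  have hG : Measurable (Function.uncurry fun (o : Fin (t + 1) → Y)
      (p : Y × (Fin (memLen m d) → X)) => F o (S.beliefUpdate t (S.belief t o, p.1))) :=
    hF.comp (g := Function.uncurry F) (measurable_fst.prodMk ((S.measurable_beliefUpdate t).comp
      (((S.measurable_belief t).comp measurable_fst).prodMk (by fun_prop))))
  calc ∫⁻ ω, F (S.obs t ω) (S.pathBelief (t + 1) ω) ∂P
      = ∫⁻ ω, F (S.obs t ω) (S.beliefUpdate t (S.pathBelief t ω, S.y (t + 1) ω)) ∂P := by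
        refine lintegral_congr_ae ?_
        filter_upwards [S.pathBelief_succ t] with ω hω
        rw [hω]
    _ = ∫⁻ ω, ∫⁻ p, F (S.obs t ω) (S.beliefUpdate t (S.pathBelief t ω, p.1))
          ∂(S.predictionKernel t (S.pathBelief t ω)) ∂P := S.lintegral_obs_next t hG
    _ = _ := by
        refine lintegral_congr fun ω => ?_
        rw [S.lintegral_beliefTransition t _ hF.of_uncurry_left]

end Source

end CausalCoding

/-! ### Outputs, costs and the cost-to-go of a belief policy. -/

namespace CausalCoding

/-- The history `q_{[0,t]}` obtained from `q_{[0,t-1]}` and `q_t`. -/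
def Hist.snoc {M : ℕ → ℕ} {t : ℕ} (h : Hist M t) (k : Fin (M t)) : Hist M (t + 1) :=
  Fin.snoc (α := fun s : Fin (t + 1) => Fin (M s)) h k

/-- A policy that determines `q_t` from the belief `π_t` and `q_{[0,t-1]}`. -/
structure BeliefPolicy (X : Type*) [MeasurableSpace X] (m d : ℕ) (M : ℕ → ℕ) where
  toFun : ∀ t : ℕ, Hist M t → ProbabilityMeasure (Fin (memLen m d) → X) → Fin (M t)
  measurable_toFun : ∀ t h, Measurable (toFun t h)

namespace Encoder

variable {Y : Type*} [MeasurableSpace Y] {M : ℕ → ℕ}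

lemma outputs_succ (Q : Encoder Y M) (y : ℕ → Y) (t : ℕ) :
    Q.outputs y (t + 1) = (Q.outputs y t).snoc (Q.toFun t (fun s => y s) (Q.outputs y t)) := rfl

/-- The outputs `q_{[0,t-1]}` as a function of `y_{[0,t-1]}`. -/
def finOutputs (Q : Encoder Y M) : ∀ t : ℕ, (Fin t → Y) → Hist M t
  | 0, _ => fun s => s.elim0
  | t + 1, y => (Q.finOutputs t fun s => y s.castSucc).snoc
      (Q.toFun t y (Q.finOutputs t fun s => y s.castSucc))

lemma outputs_eq_finOutputs (Q : Encoder Y M) (y : ℕ → Y) (t : ℕ) :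
    Q.outputs y t = Q.finOutputs t fun s => y s := by
  induction t with
  | zero => rfl
  | succ t ih => rw [outputs_succ, ih]; rfl

lemma measurable_finOutputs (Q : Encoder Y M) (t : ℕ) : Measurable (Q.finOutputs t) := by
  induction t with
  | zero => exact measurable_const
  | succ t ih =>
    have h : Measurable fun y : Fin (t + 1) → Y => Q.finOutputs t fun s => y s.castSucc :=
      ih.comp (by fun_prop)
    exact (measurable_of_countable fun p : Hist M t × Fin (M t) => p.1.snoc p.2).comp
      (h.prodMk ((Q.measurable_toFun t).comp (measurable_id.prodMk h)))

lemma outputs_congr {Q Q' : Encoder Y M} {t : ℕ} (h : ∀ s < t, Q.toFun s = Q'.toFun s) (y : ℕ → Y) :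
    Q.outputs y t = Q'.outputs y t := by
  induction t with
  | zero => rfl
  | succ t ih =>
    rw [outputs_succ, outputs_succ, ih fun s hs => h s (hs.trans t.lt_succ_self),
      h t t.lt_succ_self]

end Encoder

namespace Source

variable {Ω X Y W R U : Type*} [MeasurableSpace Ω] {P : Measure Ω}
  [MeasurableSpace X] [MeasurableSpace Y] [MeasurableSpace W] [MeasurableSpace R]
  {m d : ℕ} {M : ℕ → ℕ}

lemma outputs_succ (S : Source P X Y W R m d) (Q : Encoder Y M) (t : ℕ) (ω : Ω) :
    S.outputs Q (t + 1) ω =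
      (S.outputs Q t ω).snoc (Q.toFun t (S.obs t ω) (S.outputs Q t ω)) := rfl

lemma outputs_succ_eq (S : Source P X Y W R m d) (Q : Encoder Y M) (t : ℕ) (ω : Ω) :
    S.outputs Q (t + 1) ω = Q.finOutputs (t + 1) (S.obs t ω) :=
  Q.outputs_eq_finOutputs _ _

lemma outputs_congr (S : Source P X Y W R m d) {Q Q' : Encoder Y M} {t : ℕ}
    (h : ∀ s < t, Q.toFun s = Q'.toFun s) : S.outputs Q t = S.outputs Q' t :=
  funext fun _ => Encoder.outputs_congr h _

lemma measurable_outputs (S : Source P X Y W R m d) (Q : Encoder Y M) (t : ℕ) :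
    Measurable (S.outputs Q t) := by
  rw [show S.outputs Q t = fun ω => Q.finOutputs t fun s => S.y s ω from
    funext fun ω => Q.outputs_eq_finOutputs _ _]
  exact (Q.measurable_finOutputs t).comp (measurable_pi_lambda _ fun s => S.measurable_y s)

section Cost

variable (S : Source P X Y W R m d) (c : (Fin (memLen m d) → X) → U → ℝ)

/-- The expected cost at time `t`. -/
def stageCost (Q : Encoder Y M) (γ : Receiver M U) (t : ℕ) : ENNReal :=
  ∫⁻ ω, ENNReal.ofReal (c (S.state t ω) (γ t (S.outputs Q (t + 1) ω))) ∂P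

/-- The expected cost over the times `s, …, s + n - 1`. -/
def costFrom (Q : Encoder Y M) (γ : Receiver M U) (s n : ℕ) : ENNReal :=
  ∑ r ∈ Finset.range n, S.stageCost c Q γ (s + r)

lemma costFrom_add (Q : Encoder Y M) (γ : Receiver M U) (t n : ℕ) :
    S.costFrom c Q γ 0 (t + n) = S.costFrom c Q γ 0 t + S.costFrom c Q γ t n := by
  simp [costFrom, Finset.sum_range_add]

lemma costFrom_succ (Q : Encoder Y M) (γ : Receiver M U) (s n : ℕ) :
    S.costFrom c Q γ s (n + 1) = S.stageCost c Q γ s + S.costFrom c Q γ (s + 1) n := by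
  rw [costFrom, Finset.sum_range_succ', add_comm, costFrom]
  simp only [add_zero, add_assoc, add_comm 1]

lemma costFrom_zero_congr {Q Q' : Encoder Y M} {γ γ' : Receiver M U} {t : ℕ}
    (h : ∀ s < t, Q.toFun s = Q'.toFun s) (hγ : ∀ s < t, γ s = γ' s) :
    S.costFrom c Q γ 0 t = S.costFrom c Q' γ' 0 t := by
  refine Finset.sum_congr rfl fun r hr => ?_
  have hr' : r < t := Finset.mem_range.1 hr
  rw [Nat.zero_add, stageCost, stageCost]
  rw [S.outputs_congr fun s hs => h s (by omega), hγ r hr']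

variable {c} in
lemma measurable_ofReal_cost [MeasurableSpace U] (hc : Measurable (Function.uncurry c)) (v : U) :
    Measurable fun z => ENNReal.ofReal (c z v) :=
  (hc.comp (f := fun z => (z, v)) (by fun_prop)).ennreal_ofReal

end Cost

/-- Nonnegativity lets the whole comparison be carried out in `[0, ∞]`, free of integrability
conditions. -/
lemma cost_eq_toReal [MeasurableSpace U] (S : Source P X Y W R m d)
    {c : (Fin (memLen m d) → X) → U → ℝ}
    (hc : Measurable (Function.uncurry c)) (hc0 : ∀ z v, 0 ≤ c z v) (T : ℕ) (Q : Encoder Y M)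
    (γ : Receiver M U) : S.cost c T Q γ = (S.costFrom c Q γ 0 T).toReal := by
  have hm : ∀ t, Measurable fun ω => c (S.state t ω) (γ t (S.outputs Q (t + 1) ω)) := fun t =>
    hc.comp ((S.measurable_state t).prodMk
      ((measurable_of_countable (γ t)).comp (S.measurable_outputs Q (t + 1))))
  rw [cost, integral_eq_lintegral_of_nonneg_ae
    (Filter.Eventually.of_forall fun ω => Finset.sum_nonneg fun t _ => hc0 _ _)
    (Finset.measurable_fun_sum _ fun t _ => hm t).aestronglyMeasurable]
  congr 1
  simp only [costFrom, Nat.zero_add]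
  simp only [stageCost]
  rw [← lintegral_finsetSum _ fun t _ => (hm t).ennreal_ofReal]
  exact lintegral_congr fun ω => ENNReal.ofReal_sum_of_nonneg fun t _ => hc0 _ _

variable [IsProbabilityMeasure P]

lemma costFrom_ne_top (S : Source P X Y W R m d) {c : (Fin (memLen m d) → X) → U → ℝ}
    (hc : ∃ B, ∀ z v, c z v ≤ B) (Q : Encoder Y M) (γ : Receiver M U) (s n : ℕ) :
    S.costFrom c Q γ s n ≠ ⊤ := by
  obtain ⟨B, hB⟩ := hc
  refine ENNReal.sum_ne_top.2 fun r _ => ne_top_of_le_ne_top (ENNReal.ofReal_ne_top (r := B)) ?_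
  calc _ ≤ ∫⁻ _, ENNReal.ofReal B ∂P :=
        lintegral_mono fun ω => ENNReal.ofReal_le_ofReal (hB _ _)
    _ = _ := by simp

section Belief

variable [TopologicalSpace X] [PolishSpace X] [BorelSpace X] [Nonempty X]

/-- From time `t` on, the encoder `Q` applies the belief policy `q`. -/
def FollowsFrom (S : Source P X Y W R m d) (Q : Encoder Y M) (q : BeliefPolicy X m d M) (t : ℕ) :
    Prop :=
  ∀ s, t ≤ s → ∀ y h, Q.toFun s y h = q.toFun s h (S.belief s y)

/-- The encoder that uses `Q` before time `t` and the belief policy `q` from time `t` on. -/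
def splice (S : Source P X Y W R m d) (Q : Encoder Y M) (q : BeliefPolicy X m d M) (t : ℕ) :
    Encoder Y M where
  toFun s y h := if s < t then Q.toFun s y h else q.toFun s h (S.belief s y)
  measurable_toFun s := by
    by_cases hs : s < t
    · simpa only [hs, if_true] using Q.measurable_toFun s
    · simp only [hs, if_false]
      exact measurable_from_prod_countable_left fun h =>
        (q.measurable_toFun s h).comp (S.measurable_belief s)

lemma splice_toFun_of_lt (S : Source P X Y W R m d) (Q : Encoder Y M) (q : BeliefPolicy X m d M)
    {s t : ℕ} (h : s < t) : (S.splice Q q t).toFun s = Q.toFun s := by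
  simp [splice, h]

lemma splice_toFun_of_le (S : Source P X Y W R m d) (Q : Encoder Y M) (q : BeliefPolicy X m d M)
    {s t : ℕ} (hs : t ≤ s) (y : Fin (s + 1) → Y) (h : Hist M s) :
    (S.splice Q q t).toFun s y h = q.toFun s h (S.belief s y) := by
  simp [splice, hs.not_gt]

lemma followsFrom_splice (S : Source P X Y W R m d) (Q : Encoder Y M) (q : BeliefPolicy X m d M)
    (t : ℕ) : S.FollowsFrom (S.splice Q q t) q t :=
  fun _ hs y h => S.splice_toFun_of_le Q q hs y h

/-- The receiver's decision is a function of `y_{[0,s]}`, so conditioning on these observations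
replaces `z_s` by its law `π_s`. -/
lemma stageCost_eq [MeasurableSpace U] (S : Source P X Y W R m d)
    {c : (Fin (memLen m d) → X) → U → ℝ} (γ : Receiver M U) (hc : Measurable (Function.uncurry c))
    (Q : Encoder Y M) (s : ℕ) :
    S.stageCost c Q γ s = ∫⁻ ω, ∫⁻ z, ENNReal.ofReal (c z (γ s (S.outputs Q (s + 1) ω)))
      ∂(S.pathBelief s ω : Measure (Fin (memLen m d) → X)) ∂P := by
  simp only [stageCost, outputs_succ_eq]
  exact S.lintegral_obs_state s (F := fun o z => ENNReal.ofReal (c z (γ s (Q.finOutputs (s + 1) o))))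
    ((measurable_from_prod_countable_right fun h => measurable_ofReal_cost hc (γ s h) :
      Measurable fun p : Hist M (s + 1) × (Fin (memLen m d) → X) =>
        ENNReal.ofReal (c p.2 (γ s p.1))).comp
      (((Q.measurable_finOutputs (s + 1)).comp measurable_fst).prodMk measurable_snd))

variable [MeasurableSpace.CountablyGenerated Y]

section CostToGo

variable (S : Source P X Y W R m d) (c : (Fin (memLen m d) → X) → U → ℝ)
  (q : BeliefPolicy X m d M) (γ : Receiver M U)

/-- The cost at time `s` for the belief `π` and the outputs `h`, plus the expectation of a
function `V` of the next belief. -/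
def stepCost (s : ℕ) (V : ProbabilityMeasure (Fin (memLen m d) → X) → ENNReal) (h : Hist M (s + 1))
    (π : ProbabilityMeasure (Fin (memLen m d) → X)) : ENNReal :=
  ∫⁻ z, ENNReal.ofReal (c z (γ s h)) ∂(π : Measure (Fin (memLen m d) → X)) +
    ∫⁻ π', V π' ∂(S.beliefTransition s π)

/-- The expected cost over the times `s, …, s + n - 1` given `π_s` and `q_{[0,s-1]}`. -/
def costToGo : ℕ → ∀ s : ℕ, Hist M s → ProbabilityMeasure (Fin (memLen m d) → X) → ENNReal
  | 0, _, _, _ => 0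
  | n + 1, s, h, π => S.stepCost c γ s (costToGo n (s + 1) (h.snoc (q.toFun s h π)))
      (h.snoc (q.toFun s h π)) π

variable [MeasurableSpace U] {c}

lemma measurable_stepCost (hc : Measurable (Function.uncurry c)) (s : ℕ)
    {V : ProbabilityMeasure (Fin (memLen m d) → X) → ENNReal} (hV : Measurable V)
    (h : Hist M (s + 1)) : Measurable (S.stepCost c γ s V h) := by
  have h1 : Measurable fun π => ∫⁻ z, ENNReal.ofReal (c z (γ s h)) ∂(beliefKernel m d X π) :=
    (measurable_ofReal_cost hc _).lintegral_kernel
  exact h1.add hV.lintegral_kernel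

lemma measurable_costToGo (hc : Measurable (Function.uncurry c)) (n : ℕ) :
    ∀ (s : ℕ) (h : Hist M s), Measurable (S.costToGo c q γ n s h) := by
  induction n with
  | zero => exact fun _ _ => measurable_const
  | succ n ih =>
    intro s h
    have hm : Measurable fun p : Fin (M s) × ProbabilityMeasure (Fin (memLen m d) → X) =>
        S.stepCost c γ s (S.costToGo c q γ n (s + 1) (h.snoc p.1)) (h.snoc p.1) p.2 :=
      measurable_from_prod_countable_right fun k =>
        S.measurable_stepCost γ hc s (ih (s + 1) (h.snoc k)) (h.snoc k)
    exact hm.comp ((q.measurable_toFun s h).prodMk measurable_id)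

variable {q}

/-- Nothing is assumed about how `Q` decides at time `s`: the output `q_s` is a function of
`y_{[0,s]}`, and given these the next belief has law `beliefTransition s π_s`. Hence the formula
applies both to an arbitrary decision at `s` and to its replacement. -/
lemma costFrom_succ_eq_lintegral_stepCost (hc : Measurable (Function.uncurry c)) {Q : Encoder Y M}
    {s n : ℕ} (h : S.costFrom c Q γ (s + 1) n =
      ∫⁻ ω, S.costToGo c q γ n (s + 1) (S.outputs Q (s + 1) ω) (S.pathBelief (s + 1) ω) ∂P) :
    S.costFrom c Q γ s (n + 1) = ∫⁻ ω, S.stepCost c γ s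
      (S.costToGo c q γ n (s + 1) (S.outputs Q (s + 1) ω)) (S.outputs Q (s + 1) ω)
        (S.pathBelief s ω) ∂P := by
  have hm : Measurable fun p : Hist M (s + 1) × ProbabilityMeasure (Fin (memLen m d) → X) =>
      ∫⁻ z, ENNReal.ofReal (c z (γ s p.1)) ∂(beliefKernel m d X p.2) :=
    measurable_from_prod_countable_right fun h =>
      (measurable_ofReal_cost hc (γ s h)).lintegral_kernel
  have hF : Measurable (Function.uncurry fun (o : Fin (s + 1) → Y)
      (π : ProbabilityMeasure (Fin (memLen m d) → X)) =>
        S.costToGo c q γ n (s + 1) (Q.finOutputs (s + 1) o) π) :=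
    (measurable_from_prod_countable_right fun h => S.measurable_costToGo q γ hc n (s + 1) h :
      Measurable fun p : Hist M (s + 1) × ProbabilityMeasure (Fin (memLen m d) → X) =>
        S.costToGo c q γ n (s + 1) p.1 p.2).comp
      (((Q.measurable_finOutputs (s + 1)).comp measurable_fst).prodMk measurable_snd)
  have h2 := S.lintegral_obs_pathBelief_succ s hF
  simp only [← outputs_succ_eq] at h2
  simp only [stepCost]
  rw [costFrom_succ, stageCost_eq S γ hc, h, h2, ← lintegral_add_left]
  exact hm.comp ((S.measurable_outputs Q (s + 1)).prodMk (S.measurable_pathBelief s))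

lemma costFrom_eq_lintegral_costToGo (hc : Measurable (Function.uncurry c)) {Q : Encoder Y M}
    (n : ℕ) : ∀ s : ℕ, S.FollowsFrom Q q s → S.costFrom c Q γ s n =
      ∫⁻ ω, S.costToGo c q γ n s (S.outputs Q s ω) (S.pathBelief s ω) ∂P := by
  induction n with
  | zero => intro s _; simp [costFrom, costToGo]
  | succ n ih =>
    intro s hs
    rw [S.costFrom_succ_eq_lintegral_stepCost γ hc (ih (s + 1) fun r hr => hs r (by omega))]
    refine lintegral_congr fun ω => ?_
    rw [outputs_succ, hs s le_rfl]
    rfl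

end CostToGo

end Belief

end Source

end CausalCoding

/-! ### First structural result: backward induction with randomized decisions. -/

namespace CausalCoding

namespace Source

variable {Ω X Y W R U : Type*} [MeasurableSpace Ω] {P : Measure Ω}
  [MeasurableSpace X] [MeasurableSpace Y] [MeasurableSpace W] [MeasurableSpace R]
  {m d : ℕ} {M : ℕ → ℕ}

/-- Replacing `Q` by `Q'` causes no loss, for costs in `[0, ∞]`. -/
def Dominated (S : Source P X Y W R m d) (c : (Fin (memLen m d) → X) → U → ℝ) (T : ℕ)
    (Q Q' : Encoder Y M) : Prop :=
  ∀ γ : Receiver M U, ∃ γ' : Receiver M U, S.costFrom c Q' γ' 0 T ≤ S.costFrom c Q γ 0 T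

lemma Dominated.trans {S : Source P X Y W R m d} {c : (Fin (memLen m d) → X) → U → ℝ} {T : ℕ}
    {Q₁ Q₂ Q₃ : Encoder Y M} (h₁ : S.Dominated c T Q₁ Q₂) (h₂ : S.Dominated c T Q₂ Q₃) :
    S.Dominated c T Q₁ Q₃ := fun γ =>
  let ⟨γ₁, hγ₁⟩ := h₁ γ
  let ⟨γ₂, hγ₂⟩ := h₂ γ₁
  ⟨γ₂, hγ₂.trans hγ₁⟩

variable [IsProbabilityMeasure P]

lemma nonempty_alphabet (S : Source P X Y W R m d) (Q : Encoder Y M) (t : ℕ) :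
    Nonempty (Fin (M t)) :=
  have ω := (nonempty_of_isProbabilityMeasure P).some
  ⟨Q.toFun t (S.obs t ω) (S.outputs Q t ω)⟩

lemma nonempty_beliefPolicy (S : Source P X Y W R m d) (Q : Encoder Y M) :
    Nonempty (BeliefPolicy X m d M) :=
  have := S.nonempty_alphabet Q
  ⟨⟨fun t _ _ => Classical.arbitrary (Fin (M t)), fun _ _ => measurable_const⟩⟩

variable [TopologicalSpace X] [PolishSpace X] [BorelSpace X] [Nonempty X]

/-- Decisions after the horizon are irrelevant. -/
lemma costFrom_splice_horizon (S : Source P X Y W R m d) (c : (Fin (memLen m d) → X) → U → ℝ)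
    (T : ℕ) (Q : Encoder Y M) (q : BeliefPolicy X m d M) (γ : Receiver M U) :
    S.costFrom c (S.splice Q q T) γ 0 T = S.costFrom c Q γ 0 T :=
  S.costFrom_zero_congr c (fun _ hs => S.splice_toFun_of_lt Q q hs) fun _ _ => rfl

variable [MeasurableSpace.CountablyGenerated Y] [MeasurableSpace U]

/-- The decision at time `t` can be replaced by a mixture of decisions that only depend on the
belief and the past outputs, if all later decisions are of this form. -/
lemma exists_mixture (S : Source P X Y W R m d) {c : (Fin (memLen m d) → X) → U → ℝ}
    (hc : Measurable (Function.uncurry c)) {Q : Encoder Y M} {q : BeliefPolicy X m d M} {t : ℕ}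
    (hq : S.FollowsFrom Q q (t + 1)) (n : ℕ) :
    ∃ (Q' : unitInterval → Encoder Y M) (q' : unitInterval → BeliefPolicy X m d M),
      (∀ u, S.FollowsFrom (Q' u) (q' u) t) ∧
      ∀ γ : Receiver M U, Measurable (fun u => S.costFrom c (Q' u) γ 0 (t + (n + 1))) ∧
        ∫⁻ u, S.costFrom c (Q' u) γ 0 (t + (n + 1)) = S.costFrom c Q γ 0 (t + (n + 1)) := by
  have := S.nonempty_alphabet Q t
  let A : Ω → ProbabilityMeasure (Fin (memLen m d) → X) × Hist M t :=
    fun ω => (S.pathBelief t ω, S.outputs Q t ω)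
  let B : Ω → Fin (M t) := fun ω => Q.toFun t (S.obs t ω) (S.outputs Q t ω)
  have hA : Measurable A := (S.measurable_pathBelief t).prodMk (S.measurable_outputs Q t)
  have hB : Measurable B :=
    (Q.measurable_toFun t).comp ((S.measurable_obs t).prodMk (S.measurable_outputs Q t))
  -- For uniform `u`, `ρ a u` has the conditional law of `q_t` given `(π_t, q_{[0,t-1]}) = a`;
  -- freezing `u` leaves a deterministic quantizer.
  obtain ⟨ρ, hρ, hρκ⟩ := Kernel.exists_measurable_map_eq_unitInterval (condDistrib B A P)
  let q' : unitInterval → BeliefPolicy X m d M := fun u =>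
    { toFun := Function.update q.toFun t fun h π => ρ (π, h) u
      measurable_toFun := fun s h => by
        rcases eq_or_ne s t with rfl | hs
        · rw [Function.update_self]
          exact hρ.comp (f := fun π => ((π, h), u)) (by fun_prop)
        · rw [Function.update_of_ne hs]
          exact q.measurable_toFun s h }
  refine ⟨fun u => S.splice Q (q' u) t, q', fun u => S.followsFrom_splice Q (q' u) t, fun γ => ?_⟩
  let V : ProbabilityMeasure (Fin (memLen m d) → X) × Hist M t → Fin (M t) → ENNReal := fun a k =>
    S.stepCost c γ t (S.costToGo c q γ n (t + 1) (a.2.snoc k)) (a.2.snoc k) a.1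
  have hV : Measurable (Function.uncurry V) :=
    measurable_from_prod_countable_left fun k => measurable_from_prod_countable_left fun h =>
      S.measurable_stepCost γ hc t (S.measurable_costToGo q γ hc n (t + 1) (h.snoc k)) (h.snoc k)
  have hfollow : ∀ u, S.FollowsFrom (S.splice Q (q' u) t) q (t + 1) := fun u s hs y h => by
    rw [S.splice_toFun_of_le Q (q' u) (by omega)]
    simp only [q']
    rw [Function.update_of_ne (by omega)]
  have hcost : ∀ u, S.costFrom c (S.splice Q (q' u) t) γ 0 (t + (n + 1)) =
      S.costFrom c Q γ 0 t + ∫⁻ ω, V (A ω) (ρ (A ω) u) ∂P := fun u => by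
    rw [costFrom_add, S.costFrom_zero_congr c (fun _ hs => S.splice_toFun_of_lt Q (q' u) hs)
      fun _ _ => rfl, S.costFrom_succ_eq_lintegral_stepCost γ hc
        (S.costFrom_eq_lintegral_costToGo γ hc n (t + 1) (hfollow u))]
    congr 1
    refine lintegral_congr fun ω => ?_
    rw [outputs_succ, S.outputs_congr fun _ hs => S.splice_toFun_of_lt Q (q' u) hs,
      S.splice_toFun_of_le Q (q' u) le_rfl]
    simp only [q', Function.update_self]
    rfl
  have hVρ : Measurable (Function.uncurry fun u ω => V (A ω) (ρ (A ω) u)) :=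
    hV.comp ((hA.comp measurable_snd).prodMk
      (hρ.comp ((hA.comp measurable_snd).prodMk measurable_fst)))
  simp only [hcost]
  refine ⟨measurable_const.add hVρ.lintegral_prod_right', ?_⟩
  rw [lintegral_add_left measurable_const, lintegral_const, measure_univ, mul_one, costFrom_add,
    S.costFrom_succ_eq_lintegral_stepCost γ hc
      (S.costFrom_eq_lintegral_costToGo γ hc n (t + 1) hq)]
  congr 1
  -- After the swap, the inner integral over `u` is the integral of `V (A ω)` against the
  -- conditional law of `q_t`, so averaging over `u` restores the original joint law.
  rw [lintegral_lintegral_swap hVρ.aemeasurable]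
  refine Eq.trans ?_ (lintegral_condDistrib hA hB hV).symm
  refine lintegral_congr fun ω => ?_
  rw [← hρκ, lintegral_map hV.of_uncurry_left hρ.of_uncurry_left]

/-- Each step moves the time from which a belief policy is followed back by one. The two conclusions
differ in the choice of `u`: one value for all receivers, which may then change, or a value adapted
to a receiver that is kept. -/
lemma exists_followsFrom_zero (S : Source P X Y W R m d) {c : (Fin (memLen m d) → X) → U → ℝ}
    (hc : Measurable (Function.uncurry c)) (t : ℕ) : ∀ {T : ℕ} {Q : Encoder Y M}
    {q : BeliefPolicy X m d M}, t ≤ T → S.FollowsFrom Q q t →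
      (∃ (Q' : Encoder Y M) (q' : BeliefPolicy X m d M),
        S.FollowsFrom Q' q' 0 ∧ S.Dominated c T Q Q') ∧
      ∀ γ : Receiver M U, ∃ (Q' : Encoder Y M) (q' : BeliefPolicy X m d M),
        S.FollowsFrom Q' q' 0 ∧ S.costFrom c Q' γ 0 T ≤ S.costFrom c Q γ 0 T := by
  induction t with
  | zero => exact fun _ hq => ⟨⟨_, _, hq, fun γ => ⟨γ, le_rfl⟩⟩, fun γ => ⟨_, _, hq, le_rfl⟩⟩
  | succ t ih =>
    intro T Q q hT hq
    obtain ⟨n, rfl⟩ : ∃ n, T = t + (n + 1) := ⟨T - (t + 1), by omega⟩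
    obtain ⟨Q₁, q₁, hq₁, hcost⟩ := S.exists_mixture hc hq n
    constructor
    · obtain ⟨u, hu⟩ := exists_forall_exists_le_of_lintegral_le
        (fun γ => (hcost γ).1) fun γ => (hcost γ).2.le
      obtain ⟨⟨Q₂, q₂, hq₂, hdom⟩, -⟩ := ih (T := t + (n + 1)) (by omega) (hq₁ u)
      exact ⟨Q₂, q₂, hq₂, Dominated.trans hu hdom⟩
    · intro γ
      obtain ⟨u, hu⟩ := exists_le_lintegral (hcost γ).1.aemeasurable (μ := volume)
      obtain ⟨-, h⟩ := ih (T := t + (n + 1)) (by omega) (hq₁ u)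
      obtain ⟨Q₂, q₂, hq₂, hle⟩ := h γ
      exact ⟨Q₂, q₂, hq₂, hle.trans (hu.trans_eq (hcost γ).2)⟩

/-- The first structural result: it suffices to use the beliefs and the past outputs. -/
theorem exists_belief_encoder (S : Source P X Y W R m d) {c : (Fin (memLen m d) → X) → U → ℝ}
    (hc : Measurable (Function.uncurry c)) (T : ℕ) (Q : Encoder Y M) :
    (∃ (Q' : Encoder Y M) (q' : BeliefPolicy X m d M),
      S.FollowsFrom Q' q' 0 ∧ S.Dominated c T Q Q') ∧
    ∀ γ : Receiver M U, ∃ (Q' : Encoder Y M) (q' : BeliefPolicy X m d M),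
      S.FollowsFrom Q' q' 0 ∧ S.costFrom c Q' γ 0 T ≤ S.costFrom c Q γ 0 T := by
  obtain ⟨q⟩ := S.nonempty_beliefPolicy Q
  -- The induction can start at `T`, where an arbitrary belief policy may take over at no cost.
  have h := S.exists_followsFrom_zero hc T le_rfl (S.followsFrom_splice Q q T)
  simpa only [Dominated, costFrom_splice_horizon] using h

end Source

end CausalCoding

/-! ### Second structural result: merging histories with the same `Ξ_t`. -/

namespace CausalCoding

namespace Hist

variable {M : ℕ → ℕ} {t s : ℕ}

/-- The first `t` outputs of a history. -/
def trunc (hts : t ≤ s) (h : Hist M s) : Hist M t := fun i => h ⟨i, i.2.trans_le hts⟩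

/-- The history `h` with its first outputs replaced by those of `a`. -/
def replacePrefix (h : Hist M s) (a : Hist M t) : Hist M s :=
  fun i => if hi : (i : ℕ) < t then a ⟨i, hi⟩ else h i

lemma trunc_snoc (hts : t ≤ s) (h : Hist M s) (k : Fin (M s)) :
    (h.snoc k).trunc (hts.trans s.le_succ) = h.trunc hts := by
  funext i
  exact Fin.snoc_castSucc (α := fun s : Fin (s + 1) => Fin (M s)) k h ⟨i, i.2.trans_le hts⟩

lemma replacePrefix_snoc (hts : t ≤ s) (a : Hist M t) (h : Hist M s) (k : Fin (M s)) :
    (h.snoc k).replacePrefix a = (h.replacePrefix a).snoc k := by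
  funext i
  refine Fin.lastCases ?_ (fun j => ?_) i
  · simp [replacePrefix, snoc, hts.not_gt]
  · simp [replacePrefix, snoc]

lemma replacePrefix_self (h a : Hist M t) : h.replacePrefix a = a := by
  funext i
  simp [replacePrefix]

end Hist

/-- The belief policy that continues after each history `h` of length `t` as `q` continues after
the history `a h`. -/
def BeliefPolicy.redirect {X : Type*} [MeasurableSpace X] {m d : ℕ} {M : ℕ → ℕ}
    (q : BeliefPolicy X m d M) (t : ℕ) (a : Hist M t → Hist M t) : BeliefPolicy X m d M where
  toFun s h := if hts : t ≤ s then q.toFun s (h.replacePrefix (a (h.trunc hts))) else q.toFun s h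
  measurable_toFun s h := by
    split_ifs with hts
    · exact q.measurable_toFun s _
    · exact q.measurable_toFun s h

/-- The receiver policy that follows `γ` before time `t`, and from time `t` on, after a history `h`
of length `t`, acts as `Γ h` does after the history `a h`. -/
def Receiver.redirect {M : ℕ → ℕ} {U : Type*} (γ : Receiver M U) (t : ℕ) (a : Hist M t → Hist M t)
    (Γ : Hist M t → Receiver M U) : Receiver M U := fun s h =>
  if hts : t ≤ s then
    Γ (h.trunc (hts.trans s.le_succ)) s (h.replacePrefix (a (h.trunc (hts.trans s.le_succ))))
  else γ s h

namespace Source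

variable {Ω X Y W R U : Type*} [MeasurableSpace Ω] {P : Measure Ω}
  [MeasurableSpace X] [MeasurableSpace Y] [MeasurableSpace W] [MeasurableSpace R]
  {m d : ℕ} {M : ℕ → ℕ}

lemma NoLoss.isOptimal {S : Source P X Y W R m d} {c : (Fin (memLen m d) → X) → U → ℝ} {T : ℕ}
    {Q Q' : Encoder Y M} (h : S.NoLoss c T Q Q') (hc0 : ∀ z v, 0 ≤ c z v)
    (hQ : S.IsOptimal c T Q) : S.IsOptimal c T Q' := by
  intro Q''
  refine le_trans ?_ (hQ Q'')
  have hbdd : BddBelow (Set.range fun γ : Receiver M U => S.cost c T Q' γ) :=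
    ⟨0, by
      rintro _ ⟨γ, rfl⟩
      exact integral_nonneg fun ω => Finset.sum_nonneg fun t _ => hc0 _ _⟩
  unfold value
  rcases isEmpty_or_nonempty (Receiver M U) with hU | hU
  -- Without receivers both real infima take the default value `0`.
  · rw [Real.iInf_of_isEmpty, Real.iInf_of_isEmpty]
  · refine le_ciInf fun γ => ?_
    obtain ⟨γ', hγ'⟩ := h γ
    exact (ciInf_le hbdd γ').trans hγ'

lemma measurableSet_outputs_eq (S : Source P X Y W R m d) (Q : Encoder Y M) (t : ℕ)
    (h : Hist M t) : MeasurableSet {ω | S.outputs Q t ω = h} :=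
  S.measurable_outputs Q t (measurableSet_singleton h)

variable [IsProbabilityMeasure P]

lemma cost_le_cost_iff [MeasurableSpace U] (S : Source P X Y W R m d) {c : (Fin (memLen m d) → X) → U → ℝ}
    (hc : Measurable (Function.uncurry c)) (hc0 : ∀ z v, 0 ≤ c z v) (hcB : ∃ B, ∀ z v, c z v ≤ B)
    (T : ℕ) (Q Q' : Encoder Y M) (γ γ' : Receiver M U) :
    S.cost c T Q' γ' ≤ S.cost c T Q γ ↔ S.costFrom c Q' γ' 0 T ≤ S.costFrom c Q γ 0 T := by
  rw [S.cost_eq_toReal hc hc0, S.cost_eq_toReal hc hc0,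
    ENNReal.toReal_le_toReal (S.costFrom_ne_top hcB Q' γ' 0 T) (S.costFrom_ne_top hcB Q γ 0 T)]

variable [TopologicalSpace X] [PolishSpace X] [BorelSpace X] [Nonempty X]

open Classical in
lemma coe_beliefOnBelief (S : Source P X Y W R m d) (Q : Encoder Y M) (t : ℕ) (h : Hist M t) :
    (S.beliefOnBelief Q t h : Measure (ProbabilityMeasure (Fin (memLen m d) → X))) =
      (if P {ω | S.outputs Q t ω = h} ≠ 0 then cond P {ω | S.outputs Q t ω = h} else P).map
        (S.pathBelief t) := by
  split_ifs with h0
  · exact congrArg Subtype.val (dif_pos h0)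
  · exact congrArg Subtype.val (dif_neg h0)

lemma beliefOnBelief_congr (S : Source P X Y W R m d) {Q Q' : Encoder Y M} {t : ℕ}
    (h : S.outputs Q t = S.outputs Q' t) : S.beliefOnBelief Q t = S.beliefOnBelief Q' t := by
  funext k
  refine Subtype.ext ?_
  rw [ProbabilityMeasure.val_eq_to_measure, ProbabilityMeasure.val_eq_to_measure,
    coe_beliefOnBelief, coe_beliefOnBelief, h]

lemma setLIntegral_pathBelief (S : Source P X Y W R m d) (Q : Encoder Y M) (t : ℕ) (h : Hist M t)
    {F : ProbabilityMeasure (Fin (memLen m d) → X) → ENNReal} (hF : Measurable F) :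
    ∫⁻ ω in {ω | S.outputs Q t ω = h}, F (S.pathBelief t ω) ∂P =
      P {ω | S.outputs Q t ω = h} * ∫⁻ π, F π ∂(S.beliefOnBelief Q t h :
        Measure (ProbabilityMeasure (Fin (memLen m d) → X))) := by
  by_cases h0 : P {ω | S.outputs Q t ω = h} = 0
  · rw [h0, zero_mul, setLIntegral_measure_zero _ _ h0]
  · rw [coe_beliefOnBelief, if_pos h0, lintegral_map hF (S.measurable_pathBelief t),
      ProbabilityTheory.cond,
      lintegral_smul_measure, smul_eq_mul, ← mul_assoc,
      ENNReal.mul_inv_cancel h0 (measure_ne_top _ _), one_mul]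

/-- Splitting over the finitely many histories isolates the dependence on `Ξ_t`. Null histories have
weight zero, so the default value of `beliefOnBelief` there has no effect. -/
lemma lintegral_outputs_pathBelief (S : Source P X Y W R m d) (Q : Encoder Y M) (t : ℕ)
    {F : Hist M t → ProbabilityMeasure (Fin (memLen m d) → X) → ENNReal}
    (hF : ∀ h, Measurable (F h)) :
    ∫⁻ ω, F (S.outputs Q t ω) (S.pathBelief t ω) ∂P =
      ∑ h, P {ω | S.outputs Q t ω = h} * ∫⁻ π, F h π ∂(S.beliefOnBelief Q t h :
        Measure (ProbabilityMeasure (Fin (memLen m d) → X))) := by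
  classical
  simp only [← S.setLIntegral_pathBelief Q t _ (hF _),
    ← lintegral_indicator (S.measurableSet_outputs_eq Q t _)]
  have hm : ∀ h, Measurable fun ω => F h (S.pathBelief t ω) := fun h =>
    (hF h).comp (S.measurable_pathBelief t)
  rw [← lintegral_finsetSum _ fun h _ => (hm h).indicator (S.measurableSet_outputs_eq Q t h)]
  refine lintegral_congr fun ω => ?_
  simp [Set.indicator_apply]

/-- Before time `t`, the encoder `Q` only uses `(Ξ_s, π_s, s)`. -/
def UsesBeliefsBefore (S : Source P X Y W R m d) (Q : Encoder Y M) (t : ℕ) : Prop :=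
  ∃ p : ∀ s : ℕ, ProbabilityMeasure (ProbabilityMeasure (Fin (memLen m d) → X)) →
      ProbabilityMeasure (Fin (memLen m d) → X) → Fin (M s),
    (∀ s, Measurable (Function.uncurry (p s))) ∧
    ∀ s < t, ∀ y h, Q.toFun s y h = p s (S.beliefOnBelief Q s h) (S.belief s y)

lemma FollowsFrom.usesBeliefAndOutputs {S : Source P X Y W R m d} {Q : Encoder Y M}
    {q : BeliefPolicy X m d M} (h : S.FollowsFrom Q q 0) : S.UsesBeliefAndOutputs Q :=
  ⟨q.toFun, q.measurable_toFun, fun t y k => h t t.zero_le y k⟩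

variable [MeasurableSpace.CountablyGenerated Y]

/-- Encoder and receiver both know the first `t` outputs, so they can jointly pretend that these
were `a h`; the evolution of the beliefs does not involve the outputs. -/
lemma costToGo_redirect (S : Source P X Y W R m d) (c : (Fin (memLen m d) → X) → U → ℝ)
    (q : BeliefPolicy X m d M) (γ : Receiver M U) {t : ℕ} (a : Hist M t → Hist M t)
    (Γ : Hist M t → Receiver M U) (n : ℕ) : ∀ (s : ℕ) (hts : t ≤ s) (h : Hist M s)
      (π : ProbabilityMeasure (Fin (memLen m d) → X)),
      S.costToGo c (q.redirect t a) (γ.redirect t a Γ) n s h π =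
        S.costToGo c q (Γ (h.trunc hts)) n s (h.replacePrefix (a (h.trunc hts))) π := by
  induction n with
  | zero => intros; rfl
  | succ n ih =>
    intro s hts h π
    have hk : (q.redirect t a).toFun s h = q.toFun s (h.replacePrefix (a (h.trunc hts))) := by
      simp [BeliefPolicy.redirect, hts]
    simp only [costToGo, stepCost, hk]
    simp only [ih (s + 1) (hts.trans s.le_succ), Hist.trunc_snoc hts,
      Hist.replacePrefix_snoc hts, Receiver.redirect, hts, dite_true]

variable [MeasurableSpace U]

/-- After a history `h`, the encoder continues as after the best history for `Ξ_t(h)`. The quantizer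
at time `t` then depends on `h` only through `Ξ_t(h)`, while later ones may still depend on more. -/
lemma exists_usesBeliefsBefore_succ (S : Source P X Y W R m d)
    {c : (Fin (memLen m d) → X) → U → ℝ} (hc : Measurable (Function.uncurry c)) {Q : Encoder Y M}
    {q : BeliefPolicy X m d M} (hq : S.FollowsFrom Q q 0) {t : ℕ} (ht : S.UsesBeliefsBefore Q t)
    (n : ℕ) : ∃ (Q' : Encoder Y M) (q' : BeliefPolicy X m d M),
      S.FollowsFrom Q' q' 0 ∧ S.UsesBeliefsBefore Q' (t + 1) ∧ S.Dominated c (t + n) Q Q' := by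
  have : Nonempty (Hist M t) :=
    ⟨S.outputs Q t (nonempty_of_isProbabilityMeasure P).some⟩
  have := separatesPoints_probabilityMeasure
    (α := ProbabilityMeasure (Fin (memLen m d) → X))
  let C : ProbabilityMeasure (ProbabilityMeasure (Fin (memLen m d) → X)) → Hist M t →
      Receiver M U → ENNReal := fun ξ h γ => ∫⁻ π, S.costToGo c q γ n t h π
        ∂(ξ : Measure (ProbabilityMeasure (Fin (memLen m d) → X)))
  -- The best history depends on `ξ` alone and not on the receiver, as an encoder must be fixed
  -- before the receiver is known.
  choose best hbest using fun ξ => exists_forall_exists_le (C ξ)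
  let a : Hist M t → Hist M t := fun h => best (S.beliefOnBelief Q t h)
  -- `best` need not be measurable, but only its values at the finitely many `Ξ_t(h)` matter.
  obtain ⟨e, he, hea⟩ := exists_measurable_interpolation (S.beliefOnBelief Q t) best
  let Q' := S.splice Q (q.redirect t a) 0
  have hQ' : S.FollowsFrom Q' (q.redirect t a) 0 := S.followsFrom_splice Q _ 0
  have hQQ' : ∀ s < t, Q.toFun s = Q'.toFun s := fun s hs => by
    funext y h
    rw [hq s s.zero_le, hQ' s s.zero_le]
    simp [BeliefPolicy.redirect, hs.not_ge]
  -- The quantizers before `t` are unchanged, so `Ξ_s` is the same under `Q` and `Q'` for all `s ≤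
  -- t`, including `s = t`.
  have hout : ∀ s ≤ t, S.outputs Q s = S.outputs Q' s := fun s hs =>
    S.outputs_congr fun r hr => hQQ' r (hr.trans_le hs)
  refine ⟨Q', q.redirect t a, hQ', ?_, fun γ => ?_⟩
  · obtain ⟨p, hp, hpQ⟩ := ht
    refine ⟨Function.update p t fun ξ => q.toFun t (e ξ), fun s => ?_, fun s hs y h => ?_⟩
    · rcases eq_or_ne s t with rfl | hst
      · rw [Function.update_self]
        have hm : Measurable fun x : Hist M s × ProbabilityMeasure (Fin (memLen m d) → X) =>
            q.toFun s x.1 x.2 :=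
          measurable_from_prod_countable_right fun h => q.measurable_toFun s h
        exact hm.comp ((he.comp measurable_fst).prodMk measurable_snd)
      · rw [Function.update_of_ne hst]
        exact hp s
    · rw [← S.beliefOnBelief_congr (hout s (by omega))]
      rcases eq_or_ne s t with rfl | hst
      · rw [Function.update_self, hea, hQ' s s.zero_le]
        simp only [BeliefPolicy.redirect, le_refl, dite_true, Hist.replacePrefix_self]
        rfl
      · rw [Function.update_of_ne hst, ← hQQ' s (by omega), hpQ s (by omega)]
  -- The comparison receiver may vary with `h`, since the receiver observes `h`.
  · choose Γ hΓ using fun h => hbest (S.beliefOnBelief Q t h) h γ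
    refine ⟨γ.redirect t a Γ, ?_⟩
    rw [costFrom_add, costFrom_add]
    refine add_le_add (S.costFrom_zero_congr c (fun s hs => (hQQ' s hs).symm) fun s hs => ?_).le ?_
    · funext h
      simp [Receiver.redirect, hs.not_ge]
    · rw [S.costFrom_eq_lintegral_costToGo _ hc n t fun s _ => hQ' s s.zero_le,
        S.costFrom_eq_lintegral_costToGo _ hc n t fun s _ => hq s s.zero_le,
        S.lintegral_outputs_pathBelief Q' t fun h => S.measurable_costToGo _ _ hc n t h,
        S.lintegral_outputs_pathBelief Q t fun h => S.measurable_costToGo _ _ hc n t h,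
        ← S.beliefOnBelief_congr (hout t le_rfl), ← hout t le_rfl]
      -- Both sums carry the same weights and the same `Ξ_t(h)`, so the costs compare history by
      -- history.
      refine Finset.sum_le_sum fun h _ => mul_le_mul_right ?_ _
      simp only [S.costToGo_redirect c q γ a Γ n t le_rfl, Hist.replacePrefix_self]
      exact hΓ h

lemma exists_usesBeliefsBefore (S : Source P X Y W R m d)
    {c : (Fin (memLen m d) → X) → U → ℝ} (hc : Measurable (Function.uncurry c)) {T : ℕ}
    {Q : Encoder Y M} {q : BeliefPolicy X m d M} (hq : S.FollowsFrom Q q 0) (t : ℕ) (ht : t ≤ T) :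
    ∃ (Q' : Encoder Y M) (q' : BeliefPolicy X m d M),
      S.FollowsFrom Q' q' 0 ∧ S.UsesBeliefsBefore Q' t ∧ S.Dominated c T Q Q' := by
  induction t with
  | zero =>
    have := S.nonempty_alphabet Q
    exact ⟨Q, q, hq, ⟨fun s _ _ => Classical.arbitrary (Fin (M s)), fun _ => measurable_const,
      fun s hs => absurd hs s.not_lt_zero⟩, fun γ => ⟨γ, le_rfl⟩⟩
  | succ t ih =>
    obtain ⟨Q₁, q₁, hq₁, hQ₁, hdom⟩ := ih (by omega)
    obtain ⟨n, rfl⟩ : ∃ n, T = t + n := ⟨T - t, by omega⟩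
    obtain ⟨Q₂, q₂, hq₂, hQ₂, hdom'⟩ := S.exists_usesBeliefsBefore_succ hc hq₁ hQ₁ n
    exact ⟨Q₂, q₂, hq₂, hQ₂, hdom.trans hdom'⟩

/-- The second structural result: it suffices to use `(Ξ_t, π_t, t)`. -/
theorem exists_usesBeliefs (S : Source P X Y W R m d)
    {c : (Fin (memLen m d) → X) → U → ℝ} (hc : Measurable (Function.uncurry c)) (T : ℕ)
    (Q : Encoder Y M) : ∃ Q' : Encoder Y M, S.UsesBeliefs Q' ∧ S.Dominated c T Q Q' := by
  obtain ⟨⟨Q₁, q₁, hq₁, hdom₁⟩, -⟩ := S.exists_belief_encoder hc T Q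
  obtain ⟨Q₂, q₂, hq₂, ⟨p, hp, hpQ⟩, hdom₂⟩ := S.exists_usesBeliefsBefore hc hq₁ T le_rfl
  have := S.nonempty_alphabet Q
  -- From the horizon on, constant quantizers give the required form at all times without changing
  -- the cost.
  let q : BeliefPolicy X m d M :=
    ⟨fun t _ _ => Classical.arbitrary (Fin (M t)), fun _ _ => measurable_const⟩
  have hlt : ∀ s < T, (S.splice Q₂ q T).toFun s = Q₂.toFun s := fun s hs =>
    S.splice_toFun_of_lt Q₂ q hs
  refine ⟨S.splice Q₂ q T, ⟨fun t ξ π => if t < T then p t ξ π else Classical.arbitrary (Fin (M t)),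
    fun t => ?_, fun t y h => ?_⟩, (hdom₁.trans hdom₂).trans fun γ =>
      ⟨γ, (S.costFrom_splice_horizon c T Q₂ q γ).le⟩⟩
  · by_cases ht : t < T
    · simpa only [ht, if_true] using hp t
    · simp only [ht, if_false]
      exact measurable_const
  · by_cases ht : t < T
    · simp only [ht, if_true]
      rw [hlt t ht, hpQ t ht,
        S.beliefOnBelief_congr (S.outputs_congr fun s hs => hlt s (hs.trans ht))]
    · simp only [ht, if_false]
      rw [S.splice_toFun_of_le Q₂ q (not_lt.1 ht)]

end Source

end CausalCoding

end

theorem theorem5 {Ω X Y W R U : Type*} [MeasurableSpace Ω]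
    (P : MeasureTheory.Measure Ω) [MeasureTheory.IsProbabilityMeasure P]
    [TopologicalSpace X] [PolishSpace X] [MeasurableSpace X] [BorelSpace X] [Nonempty X]
    [TopologicalSpace Y] [PolishSpace Y] [MeasurableSpace Y] [BorelSpace Y]
    [MeasurableSpace W] [MeasurableSpace R] [MeasurableSpace U]
    (m d : ℕ) (S : CausalCoding.Source P X Y W R m d)
    (M : ℕ → ℕ) (T : ℕ)
    (c : (Fin (CausalCoding.memLen m d) → X) → U → ℝ)
    (hc_meas : Measurable (Function.uncurry c))
    (hc_nonneg : ∀ z v, 0 ≤ c z v) (hc_bdd : ∃ B, ∀ z v, c z v ≤ B) :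
    -- first structural result
    (∀ Q : CausalCoding.Encoder Y M,
      (∃ Q' : CausalCoding.Encoder Y M,
        S.UsesBeliefAndOutputs Q' ∧ S.NoLoss c T Q Q') ∧
      -- for a given receiver, the replacement can be made without changing the receiver
      (∀ γ : CausalCoding.Receiver M U, ∃ Q' : CausalCoding.Encoder Y M,
        S.UsesBeliefAndOutputs Q' ∧ S.cost c T Q' γ ≤ S.cost c T Q γ)) ∧
    -- second structural result
    (∀ Q : CausalCoding.Encoder Y M,
      ∃ Q' : CausalCoding.Encoder Y M,
        S.UsesBeliefs Q' ∧ S.NoLoss c T Q Q' ∧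
          (S.IsOptimal c T Q → S.IsOptimal c T Q')) := by
  -- Boundedness of `c` makes the extended costs finite, so inequalities in `[0, ∞]` and in `ℝ` are
  -- equivalent.
  have hiff := S.cost_le_cost_iff hc_meas hc_nonneg hc_bdd T (M := M)
  refine ⟨fun Q => ?_, fun Q => ?_⟩
  · obtain ⟨⟨Q', q', hq', hdom⟩, h⟩ := S.exists_belief_encoder hc_meas T Q
    refine ⟨⟨Q', hq'.usesBeliefAndOutputs, fun γ => ?_⟩, fun γ => ?_⟩
    · obtain ⟨γ', hγ'⟩ := hdom γ
      exact ⟨γ', (hiff Q Q' γ γ').2 hγ'⟩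
    · obtain ⟨Q'', q'', hq'', hle⟩ := h γ
      exact ⟨Q'', hq''.usesBeliefAndOutputs, (hiff Q Q'' γ γ).2 hle⟩
  · obtain ⟨Q', hQ', hdom⟩ := S.exists_usesBeliefs hc_meas T Q
    have hno : S.NoLoss c T Q Q' := fun γ =>
      let ⟨γ', hγ'⟩ := hdom γ
      ⟨γ', (hiff Q Q' γ γ').2 hγ'⟩
    exact ⟨Q', hQ', hno, hno.isOptimal hc_nonneg⟩
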